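/- Let $(X_n,d_n,m_n)$, $n\ge 1$, be proper length spaces with Radon measures $m_n$, let $p_n\in X_n$, and let $(X_\infty,d_\infty)$ be a complete metric space with at least two points and $p_\infty\in X_\infty$. Write $B_n(x,r)$, $\overline B_n(x,r)$ for open and closed balls in $X_n$ ($1\le n\le\infty$). Assume: (A4) there are increasing functions $V_n$ ($1\le n\le\infty$), $V_l,V_u:(0,\infty)\to(0,\infty)$ and constants $\alpha,\alpha'>0$, $C_{\mathrm v}\ge1$ with $$C_{\mathrm v}^{-1}\Big(\frac Rr\Big)^{\alpha}\le\frac{V_j(R)}{V_j(r)}\le C_{\mathrm v}\Big(\frac Rr\Big)^{\alpha'}\qquad(0<r\le R<\infty,\ j\in\mathbb N\cup\{u,l\}),$$ $$C_{\mathrm v}^{-1}V_n(r)\le m_n(B_n(x,r))\le C_{\mathrm v}V_n(r)\qquad(x\in X_n,\ 0<r<\operatorname{diam}X_n,\ 1\le n<\infty),$$ $$C_{\mathrm v}^{-1}V_l(r)\le V_n(r)\le C_{\mathrm v}V_u(r)\qquad(r>0,\ 1\le n\le\infty);$$ (A5) $V_n\to V_\infty$ uniformly on every interval $(0,T]$,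 $T<\infty$; (A6) $(X_n,d_n,p_n)\to(X_\infty,d_\infty,p_\infty)$ in the pointed Gromov–Hausdorff sense: for all $0<\epsilon<r$ and all large $n$ there is $f:B_n(p_n,r)\to X_\infty$ with $f(p_n)=p_\infty$, $|d_\infty(f(x),f(y))-d_n(x,y)|<\epsilon$ for all $x,y$, and $B_\infty(p_\infty,r-\epsilon)$ contained in the $\epsilon$-neighbourhood of $f(B_n(p_n,r))$. A *family of approximate isometries* consists of positive sequences $\epsilon_n\downarrow0$, $R_n\uparrow\infty$ and maps $f_n:\overline B_n(p_n,R_n)\to B_\infty(p_\infty,R_n)$, measurable with respect to the $m_n$-completion of the Borel $\sigma$-algebra, with $f_n(p_n)=p_\infty$, $|d_\infty(f_n(x),f_n(y))-d_n(x,y)|\le\epsilon_n$ for all $x,y\in\overline B_n(p_n,R_n)$, and such that the image of $f_n$ is a finite $2\epsilon_n$-net in $B_\infty(p_\infty,R_n)$. Given such a family, a *limit measure along a subsequence* $(n_k)$ is a Radon measure $m_\infty$ on $X_\infty$ such that, for some $C\ge1$, $C^{-1}V_\infty(r)\le m_\infty(B_\infty(x,r))\le CV_\infty(r)$ for all $x\in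 X_\infty$, $0<r<\operatorname{diam}X_\infty$, and, for every $r\in\mathbb Q_{>0}\cup\{R_n:n\ge1\}$ and every bounded uniformly continuous $\phi:B_\infty(p_\infty,r)\to\mathbb R$, $$\int_{B_\infty(p_\infty,r)}\phi\,d(f_{n_k})_\#\big(m_{n_k}|_{\overline B_{n_k}(p_{n_k},R_{n_k})}\big)\longrightarrow\int_{B_\infty(p_\infty,r)}\phi\,dm_\infty\qquad(k\to\infty).$$ Then a family of approximate isometries exists; for every such family a limit measure along some subsequence exists; and for every such family and every limit measure $m_\infty$ along a subsequence $(n_k)$ the following holds. The space $\mathcal C=C_c(X_\infty)$ is a dense subspace of $L^2(X_\infty,m_\infty)$, the formula $$\Phi_{n_k}u=(u\circ f_{n_k})\cdot\mathbf 1_{\overline B_{n_k}(p_{n_k},R_{n_k})}\qquad(u\in C_c(X_\infty))$$ gives well-defined linear operators $\Phi_{n_k}:\mathcal C\to L^2(X_{n_k},m_{n_k})$, and $$\lim_{k\to\infty}\|\Phi_{n_k}u\|_{L^2(X_{n_k},m_{n_k})}=\|u\|_{L^2(X_\infty,m_\infty)}\qquad\text{for all }u\in\mathcal C .$$ Hence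 the Hilbert spaces $L^2(X_{n_k},m_{n_k})$ converge to $L^2(X_\infty,m_\infty)$ in the Kuwae–Shioya sense: there are a dense subspace $\mathcal C$ of $L^2(X_\infty,m_\infty)$ and linear operators $\Phi_{n_k}:\mathcal C\to L^2(X_{n_k},m_{n_k})$ with $\|\Phi_{n_k}u\|\to\|u\|$ for all $u\in\mathcal C$. -/

import Mathlib

open MeasureTheory Filter Topology Metric Set
open scoped ENNReal

universe u v

/-- A length space: the distance of two points is the infimum of the lengths of the continuous
curves joining them. -/
def IsLengthSpace (X : Type u) [MetricSpace X] : Prop :=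
  ∀ x y : X, edist x y = ⨅ γ : Path x y, eVariationOn (γ : unitInterval → X) univ

/-- Pointed Gromov-Hausdorff convergence `(X i, p i) → (X∞, p∞)`. The approximations are only
constrained on the balls `B(p i, r)`; their values elsewhere are irrelevant. -/
def PointedGHConverges (X : ℕ → Type u) [∀ n, MetricSpace (X n)] (p : ∀ n, X n)
    (Xinf : Type v) [MetricSpace Xinf] (pinf : Xinf) : Prop :=
  ∀ r ε : ℝ, 0 < ε → ε < r → ∃ i₀ : ℕ, ∀ i ≥ i₀, ∃ f : X i → Xinf,
    f (p i) = pinf ∧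
    (∀ x ∈ ball (p i) r, ∀ y ∈ ball (p i) r, |dist (f x) (f y) - dist x y| < ε) ∧
    ball pinf (r - ε) ⊆ thickening ε (f '' ball (p i) r)

/-- `V` is an increasing function `(0, ∞) → (0, ∞)`. -/
def IsIncreasingPos (V : ℝ → ℝ) : Prop :=
  (∀ r, 0 < r → 0 < V r) ∧ MonotoneOn V (Ioi 0)

/-- `C⁻¹ (R/r)^α ≤ V(R)/V(r) ≤ C (R/r)^α'` for all `0 < r ≤ R < ∞`. -/
def HasGrowth (C α α' : ℝ) (V : ℝ → ℝ) : Prop :=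
  ∀ r R : ℝ, 0 < r → r ≤ R →
    C⁻¹ * (R / r) ^ α ≤ V R / V r ∧ V R / V r ≤ C * (R / r) ^ α'

/-- `C⁻¹ V(r) ≤ μ(B(x,r)) ≤ C V(r)` for all points `x` and all `0 < r < diam X`
(the diameter may be infinite). -/
def HasVolume {X : Type u} [MetricSpace X] [MeasurableSpace X] (μ : Measure X) (C : ℝ)
    (V : ℝ → ℝ) : Prop :=
  ∀ (x : X) (r : ℝ), 0 < r → ENNReal.ofReal r < ediam (univ : Set X) →
    ENNReal.ofReal (C⁻¹ * V r) ≤ μ (ball x r) ∧ μ (ball x r) ≤ ENNReal.ofReal (C * V r)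

/-- The uniform volume growth condition: `V n` and `Vinf` are the volume functions of the spaces
`X n` and of the limit space. -/
def UniformVolumeGrowth (X : ℕ → Type u) [∀ n, MetricSpace (X n)] [∀ n, MeasurableSpace (X n)]
    (m : ∀ n, Measure (X n)) (V : ℕ → ℝ → ℝ) (Vinf : ℝ → ℝ) : Prop :=
  ∃ (Vl Vu : ℝ → ℝ) (α α' C : ℝ), 0 < α ∧ 0 < α' ∧ 1 ≤ C ∧
    (∀ n, IsIncreasingPos (V n)) ∧ IsIncreasingPos Vinf ∧
    IsIncreasingPos Vl ∧ IsIncreasingPos Vu ∧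
    (∀ n, HasGrowth C α α' (V n)) ∧ HasGrowth C α α' Vl ∧ HasGrowth C α α' Vu ∧
    (∀ n, HasVolume (m n) C (V n)) ∧
    (∀ n r, 0 < r → C⁻¹ * Vl r ≤ V n r ∧ V n r ≤ C * Vu r) ∧
    (∀ r, 0 < r → C⁻¹ * Vl r ≤ Vinf r ∧ Vinf r ≤ C * Vu r)

/-- `V n → Vinf` uniformly on compact subsets of `[0, ∞)`. The functions live on `(0, ∞)` and
extend by the value `0` at `0`, so this is uniform convergence on every interval `(0, T]`. -/
def VolumeConverges (V : ℕ → ℝ → ℝ) (Vinf : ℝ → ℝ) : Prop :=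
  ∀ T : ℝ, TendstoUniformlyOn V Vinf atTop (Ioc 0 T)

/-- A sequence of `ε n`-approximate isometries `f n` from the closed ball of radius `R n` in `X n`
to the open ball of radius `R n` in the limit space, where `ε n ↓ 0` and `R n ↑ ∞`; the values of
`f n` off the closed ball are irrelevant. `AEMeasurable` for the restricted measure is measurability
with respect to the completed Borel σ-algebra, as the limit space is second countable. -/
structure IsApproxIsometrySeq {X : ℕ → Type u} [∀ n, MetricSpace (X n)]
    [∀ n, MeasurableSpace (X n)] (m : ∀ n, Measure (X n)) (p : ∀ n, X n)
    {Xinf : Type v} [MetricSpace Xinf] [MeasurableSpace Xinf] (pinf : Xinf)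
    (ε R : ℕ → ℝ) (f : ∀ n, X n → Xinf) : Prop where
  eps_pos : ∀ n, 0 < ε n
  eps_anti : Antitone ε
  eps_tendsto : Tendsto ε atTop (𝓝 0)
  rad_pos : ∀ n, 0 < R n
  rad_mono : Monotone R
  rad_tendsto : Tendsto R atTop atTop
  mapsTo : ∀ n, MapsTo (f n) (closedBall (p n) (R n)) (ball pinf (R n))
  aemeasurable : ∀ n, AEMeasurable (f n) ((m n).restrict (closedBall (p n) (R n)))
  finite_image : ∀ n, (f n '' closedBall (p n) (R n)).Finite
  net : ∀ n, ∀ y ∈ ball pinf (R n), ∃ x ∈ closedBall (p n) (R n), dist (f n x) y ≤ 2 * ε n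
  approx : ∀ n, ∀ x ∈ closedBall (p n) (R n), ∀ y ∈ closedBall (p n) (R n),
    |dist (f n x) (f n y) - dist x y| ≤ ε n
  base : ∀ n, f n (p n) = pinf

/-- The push-forward `(f n)_# (m n |_{closed ball of radius R n})`, a measure on the limit space. -/
noncomputable def pushBall {X : ℕ → Type u} [∀ n, MetricSpace (X n)]
    [∀ n, MeasurableSpace (X n)] (m : ∀ n, Measure (X n)) (p : ∀ n, X n)
    {Xinf : Type v} [MeasurableSpace Xinf] (R : ℕ → ℝ) (f : ∀ n, X n → Xinf) (n : ℕ) :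
    Measure Xinf :=
  Measure.map (f n) ((m n).restrict (closedBall (p n) (R n)))

/-- `minf` is a Radon measure on the limit space with the volume growth `Vinf` and, along the
subsequence `s`, it is the weak limit on the balls `B(p∞, r)`, `r ∈ ℚ₊ ∪ {R n}`, of the
push-forwards of the measures `m n`; the test functions are the bounded uniformly continuous
functions on `B(p∞, r)`. -/
structure IsLimitMeasure {X : ℕ → Type u} [∀ n, MetricSpace (X n)]
    [∀ n, MeasurableSpace (X n)] (m : ∀ n, Measure (X n)) (p : ∀ n, X n)
    {Xinf : Type v} [MetricSpace Xinf] [MeasurableSpace Xinf] [BorelSpace Xinf] (pinf : Xinf)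
    (Vinf : ℝ → ℝ) (R : ℕ → ℝ) (f : ∀ n, X n → Xinf) (s : ℕ → ℕ) (minf : Measure Xinf) :
    Prop where
  subseq : StrictMono s
  radon : minf.Regular
  volume : ∃ C : ℝ, 1 ≤ C ∧ HasVolume minf C Vinf
  weak : ∀ r : ℝ, ((∃ q : ℚ, 0 < q ∧ r = q) ∨ ∃ n, r = R n) →
    ∀ φ : Xinf → ℝ, UniformContinuousOn φ (ball pinf r) →
      (∃ M : ℝ, ∀ y ∈ ball pinf r, |φ y| ≤ M) →
      Tendsto (fun k => ∫ y in ball pinf r, φ y ∂(pushBall m p R f (s k))) atTop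
        (𝓝 (∫ y in ball pinf r, φ y ∂minf))

/-- The image of `C_c(Y)` in `L²(Y, μ)`: classes having a continuous compactly supported
representative. -/
def ccL2 {Y : Type v} [TopologicalSpace Y] [MeasurableSpace Y] (μ : Measure Y) :
    Submodule ℝ (Lp ℝ 2 μ) where
  carrier := {v | ∃ w : Y → ℝ, Continuous w ∧ HasCompactSupport w ∧ v =ᵐ[μ] w}
  zero_mem' := ⟨0, continuous_zero, HasCompactSupport.zero, Lp.coeFn_zero ℝ 2 μ⟩
  add_mem' := by
    rintro a b ⟨w, hw, hwc, haw⟩ ⟨w', hw', hwc', hbw⟩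
    exact ⟨w + w', hw.add hw', hwc.add hwc', (Lp.coeFn_add a b).trans (haw.add hbw)⟩
  smul_mem' := by
    rintro c a ⟨w, hw, hwc, haw⟩
    exact ⟨c • w, hw.const_smul c, hwc.smul_left (f := fun _ => c),
      (Lp.coeFn_smul c a).trans (haw.const_smul c)⟩

/-- The Hilbert spaces `L²(Y k, μ k)` converge to `L²(Yinf, μinf)` through the dense subspace `D`
and the linear operators `Φ k`. -/
def L2ConvergesVia {Y : ℕ → Type u} [∀ k, MeasurableSpace (Y k)] (μ : ∀ k, Measure (Y k))
    {Yinf : Type v} [MeasurableSpace Yinf] (μinf : Measure Yinf)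
    (D : Submodule ℝ (Lp ℝ 2 μinf)) (Φ : ∀ k, D →ₗ[ℝ] Lp ℝ 2 (μ k)) : Prop :=
  Dense (D : Set (Lp ℝ 2 μinf)) ∧
    ∀ w : D, Tendsto (fun k => ‖Φ k w‖) atTop (𝓝 ‖(w : Lp ℝ 2 μinf)‖)

/-- Convergence of the Hilbert spaces `L²(Y k, μ k)` to `L²(Yinf, μinf)` in the sense of Kuwae and
Shioya. -/
def L2Converges {Y : ℕ → Type u} [∀ k, MeasurableSpace (Y k)] (μ : ∀ k, Measure (Y k))
    {Yinf : Type v} [MeasurableSpace Yinf] (μinf : Measure Yinf) : Prop :=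
  ∃ (D : Submodule ℝ (Lp ℝ 2 μinf)) (Φ : ∀ k, D →ₗ[ℝ] Lp ℝ 2 (μ k)), L2ConvergesVia μ μinf D Φ

/-! By change of variables, `‖Φ k w‖ ^ 2` is the integral of `w ^ 2` against the push-forward
measure. Norm convergence is therefore weak convergence tested on `w ^ 2`, over a rational ball
containing the support (`IsLimitMeasure.tendsto_norm`). The operators act on classes because a
measure with the volume bounds charges every open set, so a class has at most one continuous
representative; density of `ccL2` is regularity of the measure.

The substance lies in existence. Gromov–Hausdorff approximations become measurable, finite-valued
and confined to the right ball after discretising the source and pushing points inwards along almost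
shortest curves (`exists_isBallApprox`); a diagonal choice then sends the errors to zero and the
radii to infinity. For the limit measure, the finite nets make the limit space proper, the volume
bounds control the push-forwards on balls, and a weighted Prokhorov argument gives a vague limit
(`exists_subseq_tendsto_integral_of_hasCompactSupport`). That limit inherits the volume bounds,
hence is locally doubling. Points of spheres about the base point can be pushed inwards, so the
spheres are porous and by Lebesgue density null (`measure_sphere_eq_zero_of_porous`). Null spheres
upgrade vague convergence to convergence on balls. -/

section Length

/-! ### Almost shortest curves and discretisation in length spaces. -/

variable {X : Type u} [MetricSpace X]

/-- In a length space there is a point on an almost shortest curve from `p` to `x` at prescribed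
distance from `p`. -/
theorem IsLengthSpace.exists_dist_eq (h : IsLengthSpace X) (p x : X) {t η : ℝ} (ht : 0 ≤ t)
    (htx : t ≤ dist p x) (hη : 0 < η) :
    ∃ z, dist p z = t ∧ dist z x < dist p x - t + η := by
  have h1 : (⨅ γ : Path p x, eVariationOn (γ : unitInterval → X) univ)
      < edist p x + ENNReal.ofReal η := by
    rw [← h p x]
    exact ENNReal.lt_add_right (edist_ne_top _ _) (by simpa using hη)
  obtain ⟨γ, hγ⟩ := iInf_lt_iff.1 h1
  have hc : Continuous fun s : unitInterval => dist p (γ s) := by fun_prop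
  have h2 : t ∈ range fun s : unitInterval => dist p (γ s) := by
    apply intermediate_value_univ (0 : unitInterval) 1 hc
    simpa using ⟨ht, htx⟩
  obtain ⟨s, hs⟩ := h2
  refine ⟨γ s, hs, ?_⟩
  -- Length is additive at `s`, and each half is at least as long as its chord.
  have h3 : edist p (γ s) + edist (γ s) x ≤ eVariationOn (γ : unitInterval → X) univ := by
    have e := eVariationOn.Icc_add_Icc (γ : unitInterval → X) (s := univ) (a := 0) (b := s)
      (c := 1) s.2.1 s.2.2 (mem_univ _)
    have e1 := eVariationOn.edist_le (γ : unitInterval → X) (s := univ ∩ Icc 0 s) (x := 0) (y := s)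
      ⟨mem_univ _, le_rfl, s.2.1⟩ ⟨mem_univ _, s.2.1, le_rfl⟩
    have e2 := eVariationOn.edist_le (γ : unitInterval → X) (s := univ ∩ Icc s 1) (x := s) (y := 1)
      ⟨mem_univ _, le_rfl, s.2.2⟩ ⟨mem_univ _, s.2.2, le_rfl⟩
    rw [γ.source] at e1
    rw [γ.target] at e2
    calc _ ≤ _ := add_le_add e1 e2
      _ = _ := e
      _ ≤ _ := eVariationOn.mono _ (subset_univ _)
  have h4 := h3.trans_lt hγ
  rw [edist_dist, edist_dist, edist_dist, ← ENNReal.ofReal_add dist_nonneg dist_nonneg,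
    ← ENNReal.ofReal_add dist_nonneg hη.le, ENNReal.ofReal_lt_ofReal_iff_of_nonneg (by positivity)]
    at h4
  simp only at hs
  linarith

/-- Moving points of a length space into the closed ball of radius `t` around `p`. -/
theorem IsLengthSpace.exists_retraction (h : IsLengthSpace X) (p : X) {t η : ℝ} (ht : 0 ≤ t)
    (hη : 0 < η) :
    ∃ g : X → X, (∀ x, dist p (g x) ≤ t) ∧ (∀ x, dist p x ≤ t → g x = x) ∧
      ∀ x a, 0 ≤ a → dist p x ≤ t + a → dist x (g x) < a + η := by
  have key : ∀ x, ∃ z, dist p z ≤ t ∧ (dist p x ≤ t → z = x) ∧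
      ∀ a, 0 ≤ a → dist p x ≤ t + a → dist x z < a + η := by
    intro x
    by_cases hx : dist p x ≤ t
    · exact ⟨x, hx, fun _ => rfl, fun a ha _ => by rw [dist_self]; linarith⟩
    · push Not at hx
      obtain ⟨z, hz, hzx⟩ := h.exists_dist_eq p x ht hx.le hη
      refine ⟨z, hz.le, fun h' => absurd h' (not_le.2 hx), fun a _ ha => ?_⟩
      rw [dist_comm]
      linarith
  choose g h1 h2 h3 using key
  exact ⟨g, h1, h2, h3⟩

/-- A measurable map with finitely many values that moves the points of a ball in a proper space
by less than `δ` and fixes the centre. -/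
theorem exists_simpleFunc_dist_lt [ProperSpace X] [MeasurableSpace X] [BorelSpace X] (p : X)
    (r : ℝ) {δ : ℝ} (hδ : 0 < δ) :
    ∃ q : SimpleFunc X X, q p = p ∧ ∀ x ∈ closedBall p r, dist (q x) x < δ := by
  have : Nonempty X := ⟨p⟩
  -- Placing `p` at index `0` forces the nearest-point map to fix `p`.
  let e : ℕ → X := fun k => Nat.casesOn k p (TopologicalSpace.denseSeq X)
  obtain ⟨T, hT⟩ := (isCompact_closedBall p r).elim_finite_subcover (fun k => ball (e k) δ)
    (fun k => isOpen_ball) (fun x _ => by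
      obtain ⟨k, hk⟩ := (TopologicalSpace.denseRange_denseSeq X).exists_dist_lt x hδ
      exact mem_iUnion.2 ⟨k + 1, hk⟩)
  refine ⟨SimpleFunc.nearestPt e (T.sup id), ?_, fun x hx => ?_⟩
  · have := SimpleFunc.edist_nearestPt_le e p (Nat.zero_le (T.sup id))
    simpa [e] using this
  · obtain ⟨k, hk, hkx⟩ := mem_iUnion₂.1 (hT hx)
    have := SimpleFunc.edist_nearestPt_le e x (Finset.le_sup (f := id) hk)
    rw [edist_dist, edist_dist, ENNReal.ofReal_le_ofReal_iff dist_nonneg] at this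
    exact this.trans_lt (by rwa [dist_comm])

end Length

/-! ### Existence of approximate isometries. -/

section Existence

/-- A single measurable approximate isometry between balls, with finite image. -/
structure IsBallApprox {X : Type u} [MetricSpace X] [MeasurableSpace X] (p : X)
    {Y : Type v} [MetricSpace Y] [MeasurableSpace Y] (q : Y) (ε R : ℝ) (f : X → Y) : Prop where
  mapsTo : MapsTo f (closedBall p R) (ball q R)
  measurable : Measurable f
  finite_image : (f '' closedBall p R).Finite
  net : ∀ y ∈ ball q R, ∃ x ∈ closedBall p R, dist (f x) y ≤ 2 * ε
  approx : ∀ x ∈ closedBall p R, ∀ y ∈ closedBall p R, |dist (f x) (f y) - dist x y| ≤ ε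
  base : f p = q

/-- Two points of the ball are at most `2 * R` apart, so collapsing everything costs only that much.
This is the always available level `0` of the diagonal choice. -/
theorem isBallApprox_const {X : Type u} [MetricSpace X] [MeasurableSpace X] (p : X)
    {Y : Type v} [MetricSpace Y] [MeasurableSpace Y] (q : Y) {R : ℝ} (hR : 0 < R) :
    IsBallApprox p q (2 * R) R (fun _ => q) where
  mapsTo _ _ := mem_ball_self hR
  measurable := measurable_const
  finite_image := (finite_singleton q).subset (by rintro _ ⟨x, -, rfl⟩; rfl)
  net y hy := ⟨p, mem_closedBall_self hR.le, by
    have := mem_ball'.1 hy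
    linarith⟩
  approx x hx y hy := by
    have := dist_triangle_right x y p
    have h1 := mem_closedBall.1 hx
    have h2 := mem_closedBall.1 hy
    rw [dist_self, zero_sub, abs_neg, abs_of_nonneg dist_nonneg]
    linarith
  base := rfl

/-- The map is `g ∘ σ ∘ s`, with `s` a simple function and `σ` the inward push. Applying `s` first
leaves only finitely many values, so neither `σ` nor `g` has to be measurable. Each point moves by
less than `5 * δ` before `g` acts, whence a total distortion below `11 * δ`. -/
theorem exists_isBallApprox {X : Type u} [MetricSpace X] [ProperSpace X]
    [MeasurableSpace X] [BorelSpace X] (p : X)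
    {Y : Type v} [MetricSpace Y] [MeasurableSpace Y] (q : Y) {δ R : ℝ} (hδ : 0 < δ)
    (hR : 2 * δ < R) (hX : IsLengthSpace X) (g : X → Y) (hgp : g p = q)
    (hg : ∀ x ∈ ball p (R + 4 * δ), ∀ y ∈ ball p (R + 4 * δ), |dist (g x) (g y) - dist x y| < δ)
    (hgn : ball q (R + 4 * δ - δ) ⊆ thickening δ (g '' ball p (R + 4 * δ))) :
    ∃ f : X → Y, IsBallApprox p q (12 * δ) R f := by
  -- Radius `R - 2 * δ` absorbs the error `δ` of `g`, so images land in the open ball of radius `R`.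
  obtain ⟨σ, hσt, hσf, hσd⟩ := hX.exists_retraction p (t := R - 2 * δ) (by linarith) hδ
  obtain ⟨s, hsp, hs⟩ := exists_simpleFunc_dist_lt p R hδ
  have hmem : ∀ x, σ x ∈ ball p (R + 4 * δ) := fun x => by
    rw [mem_ball']
    linarith [hσt x]
  have hp : p ∈ ball p (R + 4 * δ) := mem_ball_self (by linarith)
  have hd : ∀ x ∈ closedBall p R, dist x (σ (s x)) < 5 * δ := fun x hx => by
    have h1 := hs x hx
    have h2 := mem_closedBall'.1 hx
    have h3 := dist_triangle_right p (s x) x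
    have h4 := hσd (s x) (3 * δ) (by linarith) (by linarith)
    have h5 := dist_triangle_left x (σ (s x)) (s x)
    linarith
  have hbase : σ p = p := hσf p (by rw [dist_self]; linarith)
  refine ⟨fun x => g (σ (s x)), ?_, ?_, ?_, ?_, ?_, ?_⟩
  · intro x _
    have h1 := abs_lt.1 (hg _ hp _ (hmem (s x)))
    rw [hgp] at h1
    rw [mem_ball']
    linarith [h1.2, hσt (s x)]
  · exact (s.map fun x => g (σ x)).measurable
  · exact (s.map fun x => g (σ x)).finite_range.subset (image_subset_range _ _)
  · intro y hy
    obtain ⟨_, ⟨z, hz, rfl⟩, hzy⟩ := mem_thickening_iff.1 (hgn (by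
      rw [mem_ball] at hy ⊢
      linarith : y ∈ ball q (R + 4 * δ - δ)))
    have h0 := abs_lt.1 (hg _ hp _ hz)
    rw [hgp] at h0
    have h1 := dist_triangle q y (g z)
    have h2 := mem_ball'.1 hy
    -- The point `z` may lie outside the ball of radius `R`, so `σ z` replaces it.
    have h3 := hσd z (4 * δ) (by linarith) (by linarith)
    have h4 : σ z ∈ closedBall p R := by
      rw [mem_closedBall']
      linarith [hσt z]
    refine ⟨σ z, h4, ?_⟩
    have h5 := hd _ h4
    have h6 := (abs_lt.1 (hg _ (hmem (s (σ z))) _ hz)).2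
    have h7 := dist_triangle4 y (g z) (g z) (g (σ (s (σ z))))
    have h8 := dist_triangle_left (σ (s (σ z))) z (σ z)
    rw [dist_self, dist_comm (g z)] at h7
    rw [dist_comm (σ z) z] at h8
    rw [dist_comm]
    linarith
  · intro x hx y hy
    have h1 := abs_lt.1 (hg _ (hmem (s x)) _ (hmem (s y)))
    have h2 := hd x hx
    have h3 := hd y hy
    have h4 := dist_triangle4 x (σ (s x)) (σ (s y)) y
    have h5 := dist_triangle4 (σ (s x)) x y (σ (s y))
    rw [dist_comm (σ (s y)) y] at h4
    rw [dist_comm (σ (s x)) x] at h5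
    rw [abs_le]
    constructor <;> linarith [h1.1, h1.2]
  · rw [hsp, hbase, hgp]

/-- Diagonal choice of an index along which countably many eventual properties hold. -/
theorem exists_monotone_tendsto_of_eventually (P : ℕ → ℕ → Prop) (h0 : ∀ n, P n 0)
    (h : ∀ j, ∀ᶠ n in atTop, P n j) :
    ∃ J : ℕ → ℕ, Monotone J ∧ Tendsto J atTop atTop ∧ ∀ n, P n (J n) := by
  classical
  -- Requiring the property for all `m ≥ n` makes the index monotone; the cap `n` keeps it finite.
  refine ⟨fun n => Nat.findGreatest (fun j => ∀ m ≥ n, P m j) n, fun a b hab => ?_, ?_, fun n => ?_⟩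
  · exact Nat.findGreatest_mono (fun j hj m hm => hj m (hab.trans hm)) hab
  · refine tendsto_atTop.2 fun j => ?_
    obtain ⟨N, hN⟩ := eventually_atTop.1 (h j)
    filter_upwards [eventually_ge_atTop N, eventually_ge_atTop j] with n hn hj
    exact Nat.le_findGreatest hj fun m hm => hN m (hn.trans hm)
  · exact Nat.findGreatest_spec (P := fun j => ∀ m ≥ n, P m j) (Nat.zero_le n)
      (fun m _ => h0 m) n le_rfl

theorem exists_isApproxIsometrySeq {X : ℕ → Type u} [∀ n, MetricSpace (X n)]
    [∀ n, ProperSpace (X n)] [∀ n, MeasurableSpace (X n)] [∀ n, BorelSpace (X n)]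
    (m : ∀ n, Measure (X n)) (p : ∀ n, X n) {Xinf : Type v} [MetricSpace Xinf]
    [MeasurableSpace Xinf] (pinf : Xinf) (hlength : ∀ n, IsLengthSpace (X n))
    (hGH : PointedGHConverges X p Xinf pinf) :
    ∃ (ε R : ℕ → ℝ) (f : ∀ n, X n → Xinf), IsApproxIsometrySeq m p pinf ε R f := by
  -- Here `E 0 = 2 * S 0`, exactly the error of the constant map.
  let E : ℕ → ℝ := fun j => 2 / (j + 1)
  let S : ℕ → ℝ := fun j => j + 1
  have hE : ∀ j, 0 < E j := fun j => by positivity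
  have hS : ∀ j, 0 < S j := fun j => by positivity
  have hev : ∀ j, ∀ᶠ n in atTop, ∃ f : X n → Xinf, IsBallApprox (p n) pinf (E j) (S j) f := by
    intro j
    have hES : E j ≤ 2 * S j := by
      have : (1 : ℝ) ≤ j + 1 := by simp
      calc E j ≤ 2 := div_le_self (by norm_num) this
        _ ≤ 2 * S j := by simp only [S]; linarith
    obtain ⟨N, hN⟩ := hGH (S j + 4 * (E j / 12)) (E j / 12) (by linarith [hE j])
      (by linarith [hE j, hS j])
    filter_upwards [eventually_ge_atTop N] with n hn
    obtain ⟨g, hg1, hg2, hg3⟩ := hN n hn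
    obtain ⟨f, hf⟩ := exists_isBallApprox (p n) pinf (δ := E j / 12) (R := S j)
      (by linarith [hE j]) (by linarith [hE j, hS j]) (hlength n) g hg1 hg2 hg3
    refine ⟨f, ?_⟩
    rwa [show 12 * (E j / 12) = E j by ring] at hf
  obtain ⟨J, hJm, hJt, hJ⟩ := exists_monotone_tendsto_of_eventually
    (fun n j => ∃ f : X n → Xinf, IsBallApprox (p n) pinf (E j) (S j) f)
    (fun n => ⟨fun _ => pinf, by
      have := isBallApprox_const (p n) pinf (R := S 0) (hS 0)
      simpa [S, E] using this⟩) hev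
  choose f hf using hJ
  have hSt : Tendsto S atTop atTop := tendsto_atTop_add_const_right _ _ tendsto_natCast_atTop_atTop
  refine ⟨E ∘ J, S ∘ J, f, fun n => hE _, fun a b hab => ?_,
    Tendsto.comp (tendsto_const_nhds.div_atTop hSt) hJt, fun n => hS _, fun a b hab => ?_,
    hSt.comp hJt, fun n => (hf n).mapsTo, fun n => (hf n).measurable.aemeasurable,
    fun n => (hf n).finite_image, fun n => (hf n).net, fun n => (hf n).approx, fun n => (hf n).base⟩
  · have : (J a : ℝ) ≤ J b := by exact_mod_cast hJm hab
    simp only [E, Function.comp]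
    gcongr
  · have : (J a : ℝ) ≤ J b := by exact_mod_cast hJm hab
    simp only [S, Function.comp]
    linarith

end Existence

/-! ### Vague compactness by weighting. -/

section VagueCompactness

variable {E : Type v} [MetricSpace E]

/-- The continuous cutoff that is `1` on the closed ball of radius `j` and `0` off the ball of
radius `j + 1`. -/
noncomputable def ballCutoff (p : E) (j : ℕ) (y : E) : ℝ := max 0 (min 1 (j + 1 - dist p y))

theorem continuous_ballCutoff (p : E) (j : ℕ) : Continuous (ballCutoff p j) := by
  unfold ballCutoff
  fun_prop

theorem ballCutoff_nonneg (p : E) (j : ℕ) (y : E) : 0 ≤ ballCutoff p j y := le_max_left _ _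

theorem ballCutoff_le_one (p : E) (j : ℕ) (y : E) : ballCutoff p j y ≤ 1 :=
  max_le zero_le_one (min_le_left _ _)

theorem ballCutoff_eq_one {p : E} {j : ℕ} {y : E} (h : dist p y ≤ j) : ballCutoff p j y = 1 := by
  unfold ballCutoff
  rw [min_eq_left (by linarith), max_eq_right zero_le_one]

theorem ballCutoff_eq_zero {p : E} {j : ℕ} {y : E} (h : (j : ℝ) + 1 ≤ dist p y) :
    ballCutoff p j y = 0 :=
  max_eq_left ((min_le_right _ _).trans (by linarith))

/-- A positive continuous weight decaying fast enough to make measures with mass at most `M j` on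
the closed ball of radius `j + 1` uniformly tight. -/
noncomputable def ballWeight (p : E) (M : ℕ → ℝ) (y : E) : ℝ :=
  ∑' j, (1 / 2) ^ j * (M j)⁻¹ * ballCutoff p j y

variable {p : E} {M : ℕ → ℝ}

theorem ballWeight_term_nonneg (hM : ∀ j, 1 ≤ M j) (j : ℕ) (y : E) :
    0 ≤ (1 / 2) ^ j * (M j)⁻¹ * ballCutoff p j y := by
  have := ballCutoff_nonneg p j y
  have := zero_le_one.trans (hM j)
  positivity

theorem ballWeight_term_le (hM : ∀ j, 1 ≤ M j) (j : ℕ) (y : E) :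
    (1 / 2) ^ j * (M j)⁻¹ * ballCutoff p j y ≤ (1 / 2) ^ j := by
  have h0 := ballCutoff_nonneg p j y
  have h1 : (M j)⁻¹ ≤ 1 := inv_le_one_of_one_le₀ (hM j)
  have h2 : 0 ≤ (M j)⁻¹ := inv_nonneg.2 (zero_le_one.trans (hM j))
  calc (1 / 2 : ℝ) ^ j * (M j)⁻¹ * ballCutoff p j y ≤ (1 / 2) ^ j * 1 * 1 := by
        gcongr
        exact ballCutoff_le_one p j y
    _ = _ := by ring

theorem summable_ballWeight (hM : ∀ j, 1 ≤ M j) (y : E) :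
    Summable fun j => (1 / 2) ^ j * (M j)⁻¹ * ballCutoff p j y :=
  Summable.of_nonneg_of_le (fun j => ballWeight_term_nonneg hM j y)
    (fun j => ballWeight_term_le hM j y) summable_geometric_two

theorem continuous_ballWeight (hM : ∀ j, 1 ≤ M j) : Continuous (ballWeight p M) :=
  continuous_tsum (fun j => continuous_const.mul (continuous_ballCutoff p j))
    summable_geometric_two fun j y => by
      rw [Real.norm_of_nonneg (ballWeight_term_nonneg hM j y)]
      exact ballWeight_term_le hM j y

theorem le_ballWeight (hM : ∀ j, 1 ≤ M j) {k : ℕ} {y : E} (hy : dist p y ≤ k) :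
    (1 / 2) ^ k * (M k)⁻¹ ≤ ballWeight p M y := by
  have := (summable_ballWeight (p := p) hM y).le_tsum k fun j _ => ballWeight_term_nonneg hM j y
  rwa [ballCutoff_eq_one hy, mul_one] at this

theorem ballWeight_pos (hM : ∀ j, 1 ≤ M j) (y : E) : 0 < ballWeight p M y := by
  obtain ⟨k, hk⟩ := exists_nat_ge (dist p y)
  refine lt_of_lt_of_le ?_ (le_ballWeight hM hk)
  have := zero_lt_one.trans_le (hM k)
  positivity

variable [MeasurableSpace E] [BorelSpace E]

/-- The terms with `j < k` vanish on `A`. In the others the factor `(M j)⁻¹` cancels the mass of the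
ball, leaving a geometric tail. -/
theorem setLIntegral_ballWeight_le (hM : ∀ j, 1 ≤ M j) {μ : Measure E}
    (hμ : ∀ j : ℕ, μ (closedBall p (j + 1)) ≤ ENNReal.ofReal (M j)) (k : ℕ)
    {A : Set E} (hAm : MeasurableSet A) (hA : ∀ j < k, ∀ y ∈ A, (j : ℝ) + 1 ≤ dist p y) :
    ∫⁻ y in A, ENNReal.ofReal (ballWeight p M y) ∂μ
      ≤ ENNReal.ofReal (2 * (1 / 2) ^ k) := by
  have h1 : ∀ y, ENNReal.ofReal (ballWeight p M y)
      = ∑' j, ENNReal.ofReal ((1 / 2) ^ j * (M j)⁻¹ * ballCutoff p j y) := fun y =>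
    ENNReal.ofReal_tsum_of_nonneg (fun j => ballWeight_term_nonneg hM j y)
      (summable_ballWeight hM y)
  simp_rw [h1]
  have hmeas : ∀ j, AEMeasurable
      (fun y => ENNReal.ofReal ((1 / 2) ^ j * (M j)⁻¹ * ballCutoff p j y)) (μ.restrict A) :=
    fun j =>
      ((continuous_ballCutoff p j).measurable.const_mul _).ennreal_ofReal.aemeasurable
  rw [lintegral_tsum hmeas]
  have h2 : ∀ j, ∫⁻ y in A,
      ENNReal.ofReal ((1 / 2) ^ j * (M j)⁻¹ * ballCutoff p j y) ∂μ
      ≤ ENNReal.ofReal (if k ≤ j then (1 / 2) ^ j else 0) := by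
    intro j
    have hMj := zero_lt_one.trans_le (hM j)
    split_ifs with hkj
    · calc _ ≤ ∫⁻ y, ENNReal.ofReal ((1 / 2) ^ j * (M j)⁻¹ * ballCutoff p j y) ∂μ :=
            setLIntegral_le_lintegral _ _
        _ ≤ ∫⁻ y, (closedBall p (j + 1)).indicator
              (fun _ => ENNReal.ofReal ((1 / 2) ^ j * (M j)⁻¹)) y ∂μ := by
            refine lintegral_mono fun y => ?_
            by_cases hy : y ∈ closedBall p ((j : ℝ) + 1)
            · rw [indicator_of_mem hy]
              apply ENNReal.ofReal_le_ofReal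
              exact mul_le_of_le_one_right (by positivity) (ballCutoff_le_one p j y)
            · rw [mem_closedBall', not_le] at hy
              rw [ballCutoff_eq_zero hy.le]
              simp
        _ = ENNReal.ofReal ((1 / 2) ^ j * (M j)⁻¹) * μ (closedBall p (j + 1)) :=
            lintegral_indicator_const measurableSet_closedBall _
        _ ≤ ENNReal.ofReal ((1 / 2) ^ j * (M j)⁻¹) * ENNReal.ofReal (M j) := by
            gcongr
            exact hμ j
        _ = ENNReal.ofReal ((1 / 2) ^ j) := by
            rw [← ENNReal.ofReal_mul (by positivity)]
            congr 1
            field_simp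
    · rw [setLIntegral_congr_fun (g := fun _ => 0) hAm]
      · simp
      · intro y hy
        simp only
        rw [ballCutoff_eq_zero (hA j (not_le.1 hkj) y hy)]
        simp
  refine (ENNReal.tsum_le_tsum h2).trans ?_
  have h3 : HasSum (fun j => if k ≤ j then (1 / 2 : ℝ) ^ j else 0) (2 * (1 / 2) ^ k) := by
    rw [← hasSum_nat_add_iff' k]
    have h4 : ∑ i ∈ Finset.range k, (if k ≤ i then (1 / 2 : ℝ) ^ i else 0) = 0 :=
      Finset.sum_eq_zero fun i hi => if_neg (not_le.2 (Finset.mem_range.1 hi))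
    rw [h4, sub_zero]
    have h5 := hasSum_geometric_two.mul_right ((1 / 2 : ℝ) ^ k)
    have h6 : (fun j => if k ≤ j + k then (1 / 2 : ℝ) ^ (j + k) else 0)
        = fun j => (1 / 2 : ℝ) ^ j * (1 / 2) ^ k := by
      ext j
      rw [if_pos (Nat.le_add_left k j), pow_add]
    rwa [h6]
  rw [← ENNReal.ofReal_tsum_of_nonneg (fun j => by split_ifs <;> positivity) h3.summable,
    h3.tsum_eq]

/-- Vague sequential compactness of measures on a proper metric space that are uniformly bounded
on balls and do not degenerate. -/
theorem exists_subseq_tendsto_integral_of_hasCompactSupport [ProperSpace E] (p : E)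
    (μ : ℕ → Measure E) (M : ℕ → ℝ)
    (hμ : ∀ n (j : ℕ), μ n (closedBall p (j + 1)) ≤ ENNReal.ofReal (M j)) {c : ℝ} (hc : 0 < c)
    {k₀ : ℕ} (hlow : ∀ n, ENNReal.ofReal c ≤ μ n (closedBall p k₀)) :
    ∃ (s : ℕ → ℕ) (ν : Measure E), StrictMono s ∧ IsLocallyFiniteMeasure ν ∧
      ∀ φ : E → ℝ, Continuous φ → HasCompactSupport φ →
        Tendsto (fun k => ∫ y, φ y ∂(μ (s k))) atTop (𝓝 (∫ y, φ y ∂ν)) := by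
  have : Nonempty E := ⟨p⟩
  wlog hM : ∀ j, 1 ≤ M j generalizing M
  · exact this (fun j => max 1 (M j))
      (fun n j => (hμ n j).trans (ENNReal.ofReal_le_ofReal (le_max_right _ _)))
      (fun j => le_max_left _ _)
  let w : E → NNReal := fun y => (ballWeight p M y).toNNReal
  have hwc : Continuous w := continuous_real_toNNReal.comp (continuous_ballWeight hM)
  have hw0 : ∀ y, w y ≠ 0 := fun y => (Real.toNNReal_pos.2 (ballWeight_pos hM y)).ne'
  have htail : ∀ n (k : ℕ), (μ n).withDensity (fun y => (w y : ℝ≥0∞)) (closedBall p k)ᶜ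
      ≤ ENNReal.ofReal (2 * (1 / 2) ^ k) := fun n k => by
    rw [withDensity_apply _ measurableSet_closedBall.compl]
    refine setLIntegral_ballWeight_le hM (hμ n) k measurableSet_closedBall.compl fun j hj y hy => ?_
    simp only [mem_compl_iff, mem_closedBall', not_le] at hy
    have : (j : ℝ) + 1 ≤ k := by exact_mod_cast hj
    exact this.trans hy.le
  have hfin : ∀ n, (μ n).withDensity (fun y => (w y : ℝ≥0∞)) univ ≤ ENNReal.ofReal 2 := fun n => by
    rw [withDensity_apply _ MeasurableSet.univ]
    refine (setLIntegral_ballWeight_le hM (hμ n) 0 MeasurableSet.univ (by simp)).trans_eq ?_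
    rw [pow_zero, mul_one]
  have hM0 := zero_lt_one.trans_le (hM k₀)
  -- A lower bound for the weighted masses, so that normalising to probabilities preserves
  -- tightness.
  obtain ⟨c₀, hc₀⟩ : ∃ c₀ : NNReal, c₀ = ((1 / 2) ^ k₀ * (M k₀)⁻¹ * c).toNNReal := ⟨_, rfl⟩
  have hc₀pos : 0 < c₀ := by
    rw [hc₀]
    exact Real.toNNReal_pos.2 (by positivity)
  have hmass : ∀ n, (c₀ : ℝ≥0∞) ≤ (μ n).withDensity (fun y => (w y : ℝ≥0∞)) univ := fun n => by
    rw [withDensity_apply _ MeasurableSet.univ, hc₀]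
    calc ENNReal.ofReal ((1 / 2) ^ k₀ * (M k₀)⁻¹ * c)
        = ENNReal.ofReal ((1 / 2) ^ k₀ * (M k₀)⁻¹) * ENNReal.ofReal c :=
          ENNReal.ofReal_mul (by positivity)
      _ ≤ ENNReal.ofReal ((1 / 2) ^ k₀ * (M k₀)⁻¹) * μ n (closedBall p k₀) := by
          gcongr
          exact hlow n
      _ = ∫⁻ y in closedBall p k₀, ENNReal.ofReal ((1 / 2) ^ k₀ * (M k₀)⁻¹) ∂(μ n) := by simp
      _ ≤ ∫⁻ y in closedBall p k₀, w y ∂(μ n) := by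
          refine setLIntegral_mono' measurableSet_closedBall fun y hy => ?_
          exact ENNReal.ofReal_le_ofReal (le_ballWeight hM (mem_closedBall'.1 hy))
      _ ≤ ∫⁻ y in univ, w y ∂(μ n) := lintegral_mono_set (subset_univ _)
  let ν : ℕ → FiniteMeasure E := fun n =>
    ⟨(μ n).withDensity fun y => (w y : ℝ≥0∞), ⟨(hfin n).trans_lt ENNReal.ofReal_lt_top⟩⟩
  have hνmass : ∀ n, (ν n).mass ∈ Icc c₀ 2 := fun n => by
    constructor
    · rw [← ENNReal.coe_le_coe, FiniteMeasure.ennreal_mass]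
      exact hmass n
    · rw [← ENNReal.coe_le_coe, FiniteMeasure.ennreal_mass]
      exact (hfin n).trans_eq (by simp)
  have hνne : ∀ n, ν n ≠ 0 := fun n =>
    (FiniteMeasure.mass_nonzero_iff _).1 (hc₀pos.trans_le (hνmass n).1).ne'
  let u : ℕ → NNReal := fun k => c₀⁻¹ * (2 * (1 / 2) ^ k)
  have hu : Tendsto u atTop (𝓝 0) := by
    have h1 : Tendsto (fun k : ℕ => ((1 : NNReal) / 2) ^ k) atTop (𝓝 0) :=
      tendsto_pow_atTop_nhds_zero_of_lt_one zero_le (by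
        rw [← NNReal.coe_lt_coe]
        norm_num)
    have h2 := (h1.const_mul 2).const_mul c₀⁻¹
    rwa [mul_zero, mul_zero] at h2
  have hcpt := isCompact_setOfPred_probabilityMeasure_mass_eq_compl_isCompact_le hu
    (fun k => isCompact_closedBall p k) (Or.inl inferInstance)
  have hP : ∀ n, (ν n).normalize ∈ {P : ProbabilityMeasure E | ∀ k : ℕ, P (closedBall p k)ᶜ ≤ u k} := by
    intro n k
    rw [FiniteMeasure.normalize_eq_of_nonzero _ (hνne n)]
    refine mul_le_mul' (inv_anti₀ hc₀pos (hνmass n).1) ?_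
    rw [← ENNReal.coe_le_coe, FiniteMeasure.ennreal_coeFn_eq_coeFn_toMeasure]
    refine (htail n k).trans_eq ?_
    rw [ENNReal.ofReal, ENNReal.coe_inj, ← NNReal.coe_inj, Real.coe_toNNReal _ (by positivity)]
    simp
  obtain ⟨P, -, s₁, hs₁, hP₁⟩ := hcpt.tendsto_subseq hP
  obtain ⟨a, -, s₂, hs₂, ha⟩ := isCompact_Icc.tendsto_subseq fun n => hνmass (s₁ n)
  -- Undo the normalisation with the limit mass `a`, and the weight with the density `w⁻¹`; `w⁻¹ •
  -- φ` is still bounded and continuous.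
  refine ⟨s₁ ∘ s₂, a • (P : Measure E).withDensity (fun y => (((w y)⁻¹ : NNReal) : ℝ≥0∞)),
    hs₁.comp hs₂, ?_, fun φ hφ hφc => ?_⟩
  · have hwi : Continuous fun y => (w y)⁻¹ := hwc.inv₀ hw0
    have := IsLocallyFiniteMeasure.withDensity_coe (μ := (P : Measure E)) hwi
    infer_instance
  · have hwi : Continuous fun y => (w y)⁻¹ := hwc.inv₀ hw0
    have hψ : Continuous fun y => (w y)⁻¹ • φ y := hwi.smul hφ
    obtain ⟨C, hC⟩ := (hφc.smul_left (f := fun y => (w y)⁻¹)).exists_bound_of_continuous hψ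
    let ψ := BoundedContinuousFunction.ofNormedAddCommGroup _ hψ C hC
    have hlim := (ProbabilityMeasure.tendsto_iff_forall_integral_tendsto.1 hP₁) ψ
    have hlim' := (NNReal.tendsto_coe.2 ha).mul (hlim.comp hs₂.tendsto_atTop)
    have hl : ∫ y, φ y ∂(a • (P : Measure E).withDensity (fun y => (((w y)⁻¹ : NNReal) : ℝ≥0∞)))
        = a * ∫ y, ψ y ∂(P : Measure E) := by
      rw [integral_smul_nnreal_measure, integral_withDensity_eq_integral_smul hwi.measurable]
      rfl
    rw [hl]
    refine hlim'.congr fun k => ?_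
    have h1 : ∫ y, φ y ∂(μ (s₁ (s₂ k))) = ∫ y, ψ y ∂(ν (s₁ (s₂ k)) : Measure E) := by
      change _ = ∫ y, ψ y ∂((μ (s₁ (s₂ k))).withDensity fun y => (w y : ℝ≥0∞))
      rw [integral_withDensity_eq_integral_smul hwc.measurable]
      refine integral_congr_ae (Eventually.of_forall fun y => ?_)
      exact (smul_inv_smul₀ (hw0 y) (φ y)).symm
    have h2 := (ν (s₁ (s₂ k))).self_eq_mass_smul_normalize
    simp only [Function.comp]
    rw [h1]
    conv_rhs => rw [h2]
    rw [FiniteMeasure.toMeasure_smul, integral_smul_nnreal_measure]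
    rfl

end VagueCompactness

/-! ### From vague convergence to convergence on balls with null boundary sphere. -/

section VagueConvergence

variable {E : Type v} [MetricSpace E] [ProperSpace E] [MeasurableSpace E] [BorelSpace E]

/-- Vague convergence: convergence of the integrals of continuous compactly supported functions. -/
def VaguelyTendsto (μ : ℕ → Measure E) (ν : Measure E) : Prop :=
  ∀ φ : E → ℝ, Continuous φ → HasCompactSupport φ →
    Tendsto (fun k => ∫ y, φ y ∂(μ k)) atTop (𝓝 (∫ y, φ y ∂ν))

variable {μ : ℕ → Measure E} [∀ k, IsLocallyFiniteMeasure (μ k)] {ν : Measure E}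
  [IsLocallyFiniteMeasure ν]

omit [MeasurableSpace E] [BorelSpace E] in
theorem exists_continuous_compactSupport_bump {K U : Set E} (hK : IsCompact K) (hU : IsOpen U)
    (hKU : K ⊆ U) : ∃ φ : E → ℝ, Continuous φ ∧ HasCompactSupport φ ∧ (∀ y, 0 ≤ φ y) ∧
      (∀ y, K.indicator 1 y ≤ φ y) ∧ ∀ y, φ y ≤ U.indicator 1 y := by
  obtain ⟨f, hf1, hf0, hfc, hf⟩ := exists_continuous_one_zero_of_isCompact hK hU.isClosed_compl
    (disjoint_compl_right_iff_subset.2 hKU)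
  refine ⟨f, f.continuous, hfc, fun y => (hf y).1, fun y => ?_, fun y => ?_⟩
  · by_cases hy : y ∈ K
    · rw [indicator_of_mem hy, hf1 hy]
    · rw [indicator_of_notMem hy]
      exact (hf y).1
  · by_cases hy : y ∈ U
    · rw [indicator_of_mem hy]
      exact (hf y).2
    · rw [indicator_of_notMem hy, hf0 hy]
      rfl

theorem measureReal_le_integral_of_indicator_le {μ : Measure E} [IsLocallyFiniteMeasure μ]
    {K : Set E} (hK : IsCompact K) {φ : E → ℝ} (hφ : Continuous φ) (hφc : HasCompactSupport φ)
    (h : ∀ y, K.indicator 1 y ≤ φ y) : μ.real K ≤ ∫ y, φ y ∂μ := by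
  rw [← integral_indicator_one hK.measurableSet]
  refine integral_mono ?_ (hφ.integrable_of_hasCompactSupport hφc) h
  exact (integrable_indicator_iff hK.measurableSet).2 (integrableOn_const hK.measure_ne_top)

theorem integral_le_measureReal_of_le_indicator {μ : Measure E} [IsLocallyFiniteMeasure μ]
    {U : Set E} (hU : MeasurableSet U) (hUf : μ U ≠ ∞) {φ : E → ℝ} (hφ : Continuous φ)
    (hφc : HasCompactSupport φ) (h : ∀ y, φ y ≤ U.indicator 1 y) : ∫ y, φ y ∂μ ≤ μ.real U := by
  rw [← integral_indicator_one hU]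
  refine integral_mono (hφ.integrable_of_hasCompactSupport hφc) ?_ h
  exact (integrable_indicator_iff hU).2 (integrableOn_const hUf)

/-- A bump function fits between `K` and `U`; keeping the two sets distinct avoids any condition on
boundaries. -/
theorem VaguelyTendsto.le_measureReal (h : VaguelyTendsto μ ν) {K U : Set E} (hK : IsCompact K)
    (hU : IsOpen U) (hUf : ν U ≠ ∞) (hKU : K ⊆ U) {a : ℕ → ℝ} {a₀ : ℝ}
    (ha : Tendsto a atTop (𝓝 a₀)) (hle : ∀ᶠ k in atTop, a k ≤ (μ k).real K) :
    a₀ ≤ ν.real U := by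
  obtain ⟨φ, hφ, hφc, -, h1, h2⟩ := exists_continuous_compactSupport_bump hK hU hKU
  refine (le_of_tendsto_of_tendsto ha (h φ hφ hφc) ?_).trans
    (integral_le_measureReal_of_le_indicator hU.measurableSet hUf hφ hφc h2)
  filter_upwards [hle] with k hk
  exact hk.trans (measureReal_le_integral_of_indicator_le hK hφ hφc h1)

theorem VaguelyTendsto.measureReal_le (h : VaguelyTendsto μ ν) {K U : Set E} (hK : IsCompact K)
    (hU : IsOpen U) (hUf : ∀ k, μ k U ≠ ∞) (hKU : K ⊆ U) {a : ℕ → ℝ} {a₀ : ℝ}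
    (ha : Tendsto a atTop (𝓝 a₀)) (hle : ∀ᶠ k in atTop, (μ k).real U ≤ a k) :
    ν.real K ≤ a₀ := by
  obtain ⟨φ, hφ, hφc, -, h1, h2⟩ := exists_continuous_compactSupport_bump hK hU hKU
  refine (measureReal_le_integral_of_indicator_le hK hφ hφc h1).trans
    (le_of_tendsto_of_tendsto (h φ hφ hφc) ha ?_)
  filter_upwards [hle] with k hk
  exact (integral_le_measureReal_of_le_indicator hU.measurableSet (hUf k) hφ hφc h2).trans hk

/-- The tent-like bump that is `1` for `|d(p,·) - (r - δ)| ≤ δ` and `0` for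
`|d(p,·) - (r - δ)| ≥ 2δ`. -/
noncomputable def annulusBump (p : E) (r δ : ℝ) (y : E) : ℝ :=
  max 0 (min 1 (2 - |dist p y - (r - δ)| / δ))

/-- The cutoff that is `1` for `d(p,·) ≤ r - 2δ` and `0` for `d(p,·) ≥ r - δ`. -/
noncomputable def innerCutoff (p : E) (r δ : ℝ) (y : E) : ℝ :=
  max 0 (min 1 ((r - dist p y) / δ - 1))

omit [ProperSpace E] [MeasurableSpace E] [BorelSpace E] in
theorem continuous_annulusBump (p : E) (r δ : ℝ) : Continuous (annulusBump p r δ) := by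
  unfold annulusBump
  fun_prop

omit [MeasurableSpace E] [BorelSpace E] in
theorem hasCompactSupport_annulusBump (p : E) (r : ℝ) {δ : ℝ} (hδ : 0 < δ) :
    HasCompactSupport (annulusBump p r δ) := by
  refine HasCompactSupport.intro (isCompact_closedBall p (r + δ)) fun y hy => ?_
  rw [mem_closedBall', not_le] at hy
  refine max_eq_left ((min_le_right _ _).trans ?_)
  rw [sub_nonpos, le_div_iff₀ hδ]
  exact (by linarith : 2 * δ ≤ dist p y - (r - δ)).trans (le_abs_self _)

omit [ProperSpace E] [MeasurableSpace E] [BorelSpace E] in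
theorem annulusBump_nonneg (p : E) (r δ : ℝ) (y : E) : 0 ≤ annulusBump p r δ y := le_max_left _ _

omit [ProperSpace E] [MeasurableSpace E] [BorelSpace E] in
theorem one_sub_innerCutoff_le (p : E) {r δ : ℝ} (hδ : 0 < δ) {y : E} (hy : dist p y ≤ r) :
    |1 - innerCutoff p r δ y| ≤ annulusBump p r δ y := by
  have h0 : 0 ≤ innerCutoff p r δ y := le_max_left _ _
  have h1 : innerCutoff p r δ y ≤ 1 := max_le zero_le_one (min_le_left _ _)
  rw [abs_of_nonneg (by linarith)]
  by_cases h : dist p y ≤ r - 2 * δ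
  · have h2 : innerCutoff p r δ y = 1 := by
      have h3 : 1 ≤ (r - dist p y) / δ - 1 := by
        rw [le_sub_iff_add_le, le_div_iff₀ hδ]
        linarith
      unfold innerCutoff
      rw [min_eq_left h3, max_eq_right zero_le_one]
    rw [h2, sub_self]
    exact annulusBump_nonneg p r δ y
  · push Not at h
    have h2 : annulusBump p r δ y = 1 := by
      have h3 : 1 ≤ 2 - |dist p y - (r - δ)| / δ := by
        have : |dist p y - (r - δ)| / δ ≤ 1 := by
          rw [div_le_one hδ, abs_le]
          constructor <;> linarith
        linarith
      unfold annulusBump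
      rw [min_eq_left h3, max_eq_right zero_le_one]
    rw [h2]
    linarith

/-- Each point off the sphere eventually leaves the shrinking annuli, so dominated convergence
applies. -/
theorem tendsto_integral_annulusBump (p : E) (r : ℝ) (hr : ν (sphere p r) = 0) :
    Tendsto (fun n : ℕ => ∫ y, annulusBump p r (1 / ((n : ℝ) + 1)) y ∂ν) atTop (𝓝 0) := by
  have h0 : (0 : ℝ) = ∫ _ : E, (0 : ℝ) ∂ν := by simp
  rw [h0]
  refine tendsto_integral_of_dominated_convergence ((closedBall p (r + 1)).indicator 1)
    (fun n => (continuous_annulusBump p r _).aestronglyMeasurable) ?_ (fun n => ?_) ?_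
  · exact (integrable_indicator_iff measurableSet_closedBall).2
      (integrableOn_const (isCompact_closedBall _ _).measure_ne_top)
  · refine Eventually.of_forall fun y => ?_
    rw [Real.norm_of_nonneg (annulusBump_nonneg _ _ _ _)]
    by_cases hy : y ∈ closedBall p (r + 1)
    · rw [indicator_of_mem hy]
      exact max_le zero_le_one (min_le_left _ _)
    · rw [indicator_of_notMem hy]
      refine max_le le_rfl ((min_le_right _ _).trans ?_)
      rw [mem_closedBall', not_le] at hy
      have hn : (0 : ℝ) < 1 / ((n : ℝ) + 1) := by positivity
      have hn1 : (1 : ℝ) / ((n : ℝ) + 1) ≤ 1 := by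
        rw [div_le_one (by positivity)]
        simp
      rw [sub_nonpos, le_div_iff₀ hn]
      exact le_trans (by linarith) (le_abs_self _)
  · have hae : ∀ᵐ y ∂ν, y ∉ sphere p r := measure_eq_zero_iff_ae_notMem.1 hr
    filter_upwards [hae] with y hy
    have hne : 0 < |dist p y - r| := abs_pos.2 (sub_ne_zero.2 (by
      rwa [mem_sphere, dist_comm] at hy))
    have hlim : Tendsto (fun n : ℕ => (1 : ℝ) / ((n : ℝ) + 1)) atTop (𝓝 0) :=
      tendsto_one_div_add_atTop_nhds_zero_nat
    refine tendsto_const_nhds.congr' ?_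
    filter_upwards [hlim.eventually_lt_const (show (0 : ℝ) < |dist p y - r| / 3 by positivity)]
      with n hn
    have hn0 : (0 : ℝ) < 1 / ((n : ℝ) + 1) := by positivity
    refine (max_eq_left ((min_le_right _ _).trans ?_)).symm
    rw [sub_nonpos, le_div_iff₀ hn0]
    have h1 := abs_sub_abs_le_abs_sub (dist p y - r) (-(1 / ((n : ℝ) + 1)))
    rw [abs_neg, abs_of_pos hn0] at h1
    rw [show dist p y - (r - 1 / ((n : ℝ) + 1)) = dist p y - r - -(1 / ((n : ℝ) + 1)) by ring]
    linarith

omit [ProperSpace E] [MeasurableSpace E] [BorelSpace E] in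
theorem continuous_indicator_mul_innerCutoff (p : E) (r : ℝ) {δ : ℝ} (hδ : 0 < δ) {φ : E → ℝ}
    (hφ : ContinuousOn φ (ball p r)) :
    Continuous fun y => (ball p r).indicator φ y * innerCutoff p r δ y := by
  have hc : Continuous (innerCutoff p r δ) := by
    unfold innerCutoff
    fun_prop
  rw [continuous_iff_continuousAt]
  intro y
  by_cases hy : y ∈ ball p r
  · refine ContinuousAt.mul ?_ hc.continuousAt
    refine (hφ.continuousAt (isOpen_ball.mem_nhds hy)).congr ?_
    filter_upwards [isOpen_ball.mem_nhds hy] with z hz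
    rw [indicator_of_mem hz]
  · have hy' : y ∈ (closedBall p (r - δ))ᶜ := by
      rw [mem_ball', not_lt] at hy
      rw [mem_compl_iff, mem_closedBall', not_le]
      linarith
    refine (continuousAt_const (y := (0 : ℝ))).congr ?_
    filter_upwards [isClosed_closedBall.isOpen_compl.mem_nhds hy'] with z hz
    rw [mem_compl_iff, mem_closedBall', not_le] at hz
    have : innerCutoff p r δ z = 0 := by
      refine max_eq_left ((min_le_right _ _).trans ?_)
      rw [sub_nonpos, div_le_one hδ]
      linarith
    rw [this, mul_zero]

theorem abs_setIntegral_sub_integral_innerCutoff_le (μ : Measure E) [IsLocallyFiniteMeasure μ]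
    (p : E) (r : ℝ) {δ M : ℝ} (hδ : 0 < δ) {φ : E → ℝ} (hφ : ContinuousOn φ (ball p r))
    (hM : 0 ≤ M) (hφM : ∀ y ∈ ball p r, |φ y| ≤ M) :
    |∫ y in ball p r, φ y ∂μ - ∫ y, (ball p r).indicator φ y * innerCutoff p r δ y ∂μ|
      ≤ M * ∫ y, annulusBump p r δ y ∂μ := by
  have hball : μ (ball p r) ≠ ∞ :=
    ((measure_mono ball_subset_closedBall).trans_lt (isCompact_closedBall p r).measure_lt_top).ne
  have hi : Integrable ((ball p r).indicator φ) μ := by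
    rw [integrable_indicator_iff measurableSet_ball]
    refine ⟨hφ.aestronglyMeasurable measurableSet_ball, ?_⟩
    refine HasFiniteIntegral.restrict_of_bounded (C := M) hball.lt_top ?_
    filter_upwards [ae_restrict_mem measurableSet_ball] with y hy using hφM y hy
  have hic : Integrable (fun y => (ball p r).indicator φ y * innerCutoff p r δ y) μ := by
    refine hi.mul_bdd (c := 1) ?_ ?_
    · have hc : Continuous (innerCutoff p r δ) := by
        unfold innerCutoff
        fun_prop
      exact hc.aestronglyMeasurable
    · refine Eventually.of_forall fun y => ?_
      have h0 : 0 ≤ innerCutoff p r δ y := le_max_left _ _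
      rw [Real.norm_of_nonneg h0]
      exact max_le zero_le_one (min_le_left _ _)
  rw [← integral_indicator measurableSet_ball, ← integral_sub hi hic, ← integral_const_mul]
  refine (abs_integral_le_integral_abs).trans (integral_mono (hi.sub hic).abs ?_ fun y => ?_)
  · exact ((continuous_annulusBump p r δ).integrable_of_hasCompactSupport
      (hasCompactSupport_annulusBump p r hδ)).const_mul M
  · by_cases hy : y ∈ ball p r
    · simp only [indicator_of_mem hy]
      rw [show φ y - φ y * innerCutoff p r δ y = φ y * (1 - innerCutoff p r δ y) by ring, abs_mul]
      exact mul_le_mul (hφM y hy) (one_sub_innerCutoff_le p hδ (mem_ball'.1 hy).le) (abs_nonneg _)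
        hM
    · simp only [indicator_of_notMem hy, zero_mul, sub_zero, abs_zero]
      exact mul_nonneg hM (annulusBump_nonneg _ _ _ _)

/-- Cutting `φ` off near the sphere makes it a test function. The error is at most `M` times the
integral of a bump which is itself a test function, so smallness for `ν` passes to `μ k`. -/
theorem VaguelyTendsto.tendsto_setIntegral_ball (h : VaguelyTendsto μ ν) (p : E) (r : ℝ)
    (hr : ν (sphere p r) = 0) {φ : E → ℝ} (hφ : ContinuousOn φ (ball p r)) {M : ℝ}
    (hφM : ∀ y ∈ ball p r, |φ y| ≤ M) :
    Tendsto (fun k => ∫ y in ball p r, φ y ∂(μ k)) atTop (𝓝 (∫ y in ball p r, φ y ∂ν)) := by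
  wlog hM : 0 ≤ M generalizing M
  · exact this (fun y hy => (hφM y hy).trans (le_abs_self M)) (abs_nonneg M)
  rw [Metric.tendsto_atTop']
  intro η hη
  have hsmall := (tendsto_integral_annulusBump p r hr).const_mul M
  rw [mul_zero] at hsmall
  -- The annulus width is fixed by `ν` alone, before `k` varies.
  obtain ⟨n, hn⟩ := (hsmall.eventually_lt_const (show 0 < η / 3 by positivity)).exists
  obtain ⟨δ, hδ'⟩ : ∃ δ : ℝ, δ = 1 / ((n : ℝ) + 1) := ⟨_, rfl⟩
  have hδ : 0 < δ := by rw [hδ']; positivity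
  rw [← hδ'] at hn
  have h1 := (h _ (continuous_annulusBump p r δ) (hasCompactSupport_annulusBump p r hδ)).const_mul M
  have hcs : HasCompactSupport fun y => (ball p r).indicator φ y * innerCutoff p r δ y := by
    refine HasCompactSupport.intro (isCompact_closedBall p r) fun y hy => ?_
    rw [indicator_of_notMem (fun h => hy (ball_subset_closedBall h)), zero_mul]
  have h2 := h _ (continuous_indicator_mul_innerCutoff p r hδ hφ) hcs
  have h3 := Metric.tendsto_nhds.1 h2 (η / 3) (by positivity)
  obtain ⟨N, hN⟩ := eventually_atTop.1 ((h1.eventually_lt_const hn).and h3)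
  refine ⟨N, fun k hk => ?_⟩
  obtain ⟨h4, h5⟩ := hN k hk.le
  have h6 := abs_le.1 (abs_setIntegral_sub_integral_innerCutoff_le (μ k) p r hδ hφ hM hφM)
  have h7 := abs_le.1 (abs_setIntegral_sub_integral_innerCutoff_le ν p r hδ hφ hM hφM)
  rw [Real.dist_eq, abs_lt] at h5
  rw [Real.dist_eq, abs_lt]
  constructor <;> linarith [h5.1, h5.2, h6.1, h6.2, h7.1, h7.2]

end VagueConvergence

/-! ### Volume functions and radii below the diameter. -/

section Growth

theorem VolumeConverges.tendsto {V : ℕ → ℝ → ℝ} {Vinf : ℝ → ℝ} (h : VolumeConverges V Vinf)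
    {r : ℝ} (hr : 0 < r) : Tendsto (fun n => V n r) atTop (𝓝 (Vinf r)) :=
  (h r).tendsto_at ⟨hr, le_rfl⟩

/-- The growth condition is assumed for each `V n` but not for `Vinf`; it survives pointwise limits.
-/
theorem HasGrowth.of_tendsto {C α α' : ℝ} {V : ℕ → ℝ → ℝ} {Vinf : ℝ → ℝ}
    (hV : ∀ n, HasGrowth C α α' (V n)) (hpos : ∀ r, 0 < r → 0 < Vinf r)
    (h : ∀ r, 0 < r → Tendsto (fun n => V n r) atTop (𝓝 (Vinf r))) : HasGrowth C α α' Vinf := by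
  intro r R hr hrR
  have hlim := (h R (hr.trans_le hrR)).div (h r hr) (hpos r hr).ne'
  exact ⟨ge_of_tendsto' hlim fun n => (hV n r R hr hrR).1,
    le_of_tendsto' hlim fun n => (hV n r R hr hrR).2⟩

theorem HasGrowth.le_mul {C α α' : ℝ} {V : ℝ → ℝ} (h : HasGrowth C α α' V) {c r : ℝ}
    (hc : 1 ≤ c) (hr : 0 < r) (hV : 0 < V r) : V (c * r) ≤ C * c ^ α' * V r := by
  have := (h r (c * r) hr (le_mul_of_one_le_left hr.le hc)).2
  rwa [div_le_iff₀ hV, mul_div_cancel_right₀ _ hr.ne'] at this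

theorem exists_lt_ofReal_lt {r : ℝ} (hr : 0 ≤ r) {D : ℝ≥0∞} (hD : ENNReal.ofReal r < D) {b : ℝ}
    (hb : r < b) : ∃ r', r < r' ∧ r' < b ∧ ENNReal.ofReal r' < D := by
  obtain ⟨c, hc1, hc2⟩ := exists_between (lt_min hD
    ((ENNReal.ofReal_lt_ofReal_iff_of_nonneg hr).2 hb))
  have hct : c ≠ ∞ := hc2.ne_top
  refine ⟨c.toReal, ?_, ?_, ?_⟩
  · rwa [← ENNReal.ofReal_lt_iff_lt_toReal hr hct]
  · have := hc2.trans_le (min_le_right _ _)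
    rwa [ENNReal.lt_ofReal_iff_toReal_lt hct] at this
  · rw [ENNReal.ofReal_toReal hct]
    exact hc2.trans_le (min_le_left _ _)

theorem exists_dist_gt_of_ofReal_lt_ediam {Y : Type v} [MetricSpace Y] {r : ℝ}
    (h : ENNReal.ofReal r < ediam (univ : Set Y)) : ∃ a b : Y, r < dist a b := by
  by_contra! hcon
  refine absurd h (not_lt.2 (ediam_le fun a _ b _ => ?_))
  rw [edist_dist]
  exact ENNReal.ofReal_le_ofReal (hcon a b)

theorem ofReal_lt_ediam_of_lt_dist {Y : Type v} [MetricSpace Y] {r : ℝ} (hr : 0 ≤ r)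
    {a b : Y} (h : r < dist a b) : ENNReal.ofReal r < ediam (univ : Set Y) := by
  refine lt_of_lt_of_le ?_ (edist_le_ediam_of_mem (mem_univ a) (mem_univ b))
  rw [edist_dist]
  exact (ENNReal.ofReal_lt_ofReal_iff_of_nonneg hr).2 h

theorem exists_pos_ofReal_lt_ediam (Y : Type v) [MetricSpace Y] [Nontrivial Y] :
    ∃ r : ℝ, 0 < r ∧ ENNReal.ofReal r < ediam (univ : Set Y) := by
  obtain ⟨a, b, hab⟩ := exists_pair_ne Y
  have := dist_pos.2 hab
  exact ⟨dist a b / 2, by positivity, ofReal_lt_ediam_of_lt_dist (by positivity)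
    (half_lt_self this)⟩

end Growth

/-! ### Null spheres from porosity and doubling. -/

section Porosity

variable {E : Type v} [MetricSpace E] [ProperSpace E] [MeasurableSpace E] [BorelSpace E]

/-- If the points of a sphere can be pushed inwards, the sphere is null for every locally doubling
measure. -/
theorem measure_sphere_eq_zero_of_porous (ν : Measure E) [IsLocallyFiniteMeasure ν]
    [IsUnifLocDoublingMeasure ν] (p : E) {r : ℝ} (hr : 0 < r)
    (hpor : ∀ x ∈ sphere p r, ∀ t, 0 < t → t ≤ r →
      ∃ x', dist x x' ≤ t / 2 ∧ dist p x' ≤ r - t / 4) : ν (sphere p r) = 0 := by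
  -- The factor `4` is `(t / 2) / (t / 8)`: density is tested on balls of radius `t / 8` about the
  -- pushed points, which miss the sphere although their centres are up to `t / 2` from `x`.
  have hae := IsUnifLocDoublingMeasure.ae_tendsto_measure_inter_div.{_, 0} ν (sphere p r) 4
  have hfalse : ∀ᵐ x ∂ν.restrict (sphere p r), False := by
    filter_upwards [hae, ae_restrict_mem isClosed_sphere.measurableSet] with x hx hxs
    have ht : ∀ j : ℕ, 0 < r / ((j : ℝ) + 1) ∧ r / ((j : ℝ) + 1) ≤ r := fun j =>
      ⟨by positivity, div_le_self hr.le (by simp)⟩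
    choose w hw1 hw2 using fun j : ℕ => hpor x hxs _ (ht j).1 (ht j).2
    have hlim : Tendsto (fun j : ℕ => r / ((j : ℝ) + 1) / 8) atTop (𝓝[>] 0) := by
      refine tendsto_nhdsWithin_iff.2 ⟨?_, Eventually.of_forall fun j => ?_⟩
      · have := (tendsto_const_nhds (x := r)).div_atTop
          (tendsto_atTop_add_const_right _ (1 : ℝ) tendsto_natCast_atTop_atTop)
        simpa using this.div_const 8
      · have := (ht j).1
        simp only [mem_Ioi]
        positivity
    have h1 := hx w _ hlim (Eventually.of_forall fun j => by
      rw [mem_closedBall]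
      linarith [hw1 j])
    have h0 : ∀ j, sphere p r ∩ closedBall (w j) (r / ((j : ℝ) + 1) / 8) = ∅ := by
      intro j
      rw [← disjoint_iff_inter_eq_empty, disjoint_left]
      intro z hz hzw
      rw [mem_sphere'] at hz
      rw [mem_closedBall'] at hzw
      linarith [dist_triangle p (w j) z, hw2 j, (ht j).1]
    simp only [h0, measure_empty, ENNReal.zero_div] at h1
    exact zero_ne_one (tendsto_nhds_unique tendsto_const_nhds h1)
  rw [← Measure.restrict_apply_univ]
  simpa [ae_iff] using hfalse

omit [ProperSpace E] [BorelSpace E] in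
theorem HasVolume.isUnifLocDoublingMeasure [Nontrivial E] {ν : Measure E} {C C' α α' : ℝ}
    {V : ℝ → ℝ} (h : HasVolume ν C V) (hC : 0 < C) (hV : HasGrowth C' α α' V) (hC' : 0 < C')
    (hpos : ∀ r, 0 < r → 0 < V r) : IsUnifLocDoublingMeasure ν := by
  obtain ⟨d, hd0, hd⟩ := exists_pos_ofReal_lt_ediam E
  refine ⟨⟨(C * (C' * 3 ^ α') * C).toNNReal, ?_⟩⟩
  filter_upwards [Ioo_mem_nhdsGT (show 0 < d / 3 by positivity)] with t ht x
  have ht0 : 0 < t := ht.1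
  have h3 : ENNReal.ofReal (3 * t) < ediam (univ : Set E) :=
    (ENNReal.ofReal_le_ofReal (by linarith [ht.2])).trans_lt hd
  have h1 : ENNReal.ofReal t < ediam (univ : Set E) :=
    (ENNReal.ofReal_le_ofReal (by linarith [ht.2])).trans_lt hd
  calc ν (closedBall x (2 * t)) ≤ ν (ball x (3 * t)) :=
        measure_mono (closedBall_subset_ball (by linarith))
    _ ≤ ENNReal.ofReal (C * V (3 * t)) := (h x _ (by linarith) h3).2
    _ ≤ ENNReal.ofReal (C * (C' * 3 ^ α') * C * (C⁻¹ * V t)) := by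
        apply ENNReal.ofReal_le_ofReal
        have := hV.le_mul (c := 3) (by norm_num) ht0 (hpos t ht0)
        calc C * V (3 * t) ≤ C * (C' * 3 ^ α' * V t) := by gcongr
          _ = _ := by field_simp
    _ = ENNReal.ofReal (C * (C' * 3 ^ α') * C) * ENNReal.ofReal (C⁻¹ * V t) :=
        ENNReal.ofReal_mul (by positivity)
    _ ≤ ENNReal.ofReal (C * (C' * 3 ^ α') * C) * ν (closedBall x t) := by
        gcongr
        exact (h x t ht0 h1).1.trans (measure_mono ball_subset_closedBall)

end Porosity

/-! ### Geometry of approximate isometries and their push-forward measures. -/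

theorem isFiniteMeasure_pushBall {X : ℕ → Type u} [∀ n, MetricSpace (X n)]
    [∀ n, ProperSpace (X n)] [∀ n, MeasurableSpace (X n)] (m : ∀ n, Measure (X n))
    [∀ n, IsFiniteMeasureOnCompacts (m n)] (p : ∀ n, X n) {Xinf : Type v} [MeasurableSpace Xinf]
    (R : ℕ → ℝ) (f : ∀ n, X n → Xinf) (n : ℕ) : IsFiniteMeasure (pushBall m p R f n) := by
  have : IsFiniteMeasure ((m n).restrict (closedBall (p n) (R n))) :=
    ⟨by
      rw [Measure.restrict_apply_univ]
      exact (isCompact_closedBall _ _).measure_lt_top⟩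
  unfold pushBall
  infer_instance

namespace IsApproxIsometrySeq

variable {X : ℕ → Type u} [∀ n, MetricSpace (X n)] [∀ n, MeasurableSpace (X n)]
  {m : ∀ n, Measure (X n)} {p : ∀ n, X n} {Xinf : Type v} [MetricSpace Xinf]
  [MeasurableSpace Xinf] {pinf : Xinf} {ε R : ℕ → ℝ} {f : ∀ n, X n → Xinf}

/-- The finite nets make balls totally bounded; completeness does the rest. -/
theorem properSpace [CompleteSpace Xinf] (hf : IsApproxIsometrySeq m p pinf ε R f) :
    ProperSpace Xinf := by
  refine ProperSpace.of_seq_closedBall (x := pinf) (r := fun r : ℝ => r) (l := atTop) tendsto_id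
    (Eventually.of_forall fun r => ?_)
  refine TotallyBounded.isCompact_of_isClosed (Metric.totallyBounded_iff.2 fun δ hδ => ?_)
    isClosed_closedBall
  obtain ⟨n, hn1, hn2⟩ := ((hf.eps_tendsto.eventually_lt_const (show 0 < δ / 2 by positivity)).and
    (hf.rad_tendsto.eventually_gt_atTop r)).exists
  refine ⟨_, hf.finite_image n, fun y hy => ?_⟩
  obtain ⟨x, hx, hxy⟩ := hf.net n y (closedBall_subset_ball hn2 hy)
  refine mem_iUnion₂.2 ⟨f n x, mem_image_of_mem _ hx, ?_⟩
  rw [mem_ball']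
  linarith

theorem eventually_exists_near (hf : IsApproxIsometrySeq m p pinf ε R f) (y : Xinf) {δ : ℝ}
    (hδ : 0 < δ) :
    ∀ᶠ n in atTop, ∃ x ∈ closedBall (p n) (R n), dist (f n x) y < δ ∧
      |dist (p n) x - dist pinf y| < δ := by
  filter_upwards [hf.eps_tendsto.eventually_lt_const (show 0 < δ / 3 by positivity),
    hf.rad_tendsto.eventually_gt_atTop (dist pinf y)] with n hn1 hn2
  obtain ⟨x, hx, hxy⟩ := hf.net n y (mem_ball'.2 hn2)
  refine ⟨x, hx, by linarith, ?_⟩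
  have h1 := abs_le.1 (hf.approx n _ (mem_closedBall_self (hf.rad_pos n).le) x hx)
  rw [hf.base] at h1
  have h2 := dist_triangle pinf (f n x) y
  have h3 := dist_triangle_right pinf (f n x) y
  rw [abs_lt]
  constructor <;> linarith [h1.1, h1.2]

/-- Volume bounds in `X n` hold only below its diameter, so radii admissible in the limit must
become admissible there. -/
theorem eventually_ofReal_lt_ediam (hf : IsApproxIsometrySeq m p pinf ε R f) {r : ℝ} (hr : 0 ≤ r)
    (h : ENNReal.ofReal r < ediam (univ : Set Xinf)) :
    ∀ᶠ n in atTop, ENNReal.ofReal r < ediam (univ : Set (X n)) := by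
  obtain ⟨a, b, hab⟩ := exists_dist_gt_of_ofReal_lt_ediam h
  have hδ : 0 < (dist a b - r) / 3 := by linarith
  filter_upwards [hf.eventually_exists_near a hδ, hf.eventually_exists_near b hδ,
    hf.eps_tendsto.eventually_lt_const hδ] with n ⟨x, hx, hxa, _⟩ ⟨y, hy, hyb, _⟩ hn
  refine ofReal_lt_ediam_of_lt_dist hr (a := x) (b := y) ?_
  have h1 := abs_le.1 (hf.approx n x hx y hy)
  have h2 := dist_triangle4 a (f n x) (f n y) b
  rw [dist_comm a (f n x)] at h2
  linarith [h1.2]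

/-- Points of the limit space can be moved towards the base point. -/
theorem exists_dist_le (hf : IsApproxIsometrySeq m p pinf ε R f)
    (hlength : ∀ n, IsLengthSpace (X n)) (x : Xinf) {t : ℝ} (ht : 0 < t)
    (htx : t ≤ dist pinf x) : ∃ x', dist x x' ≤ t / 2 ∧ dist pinf x' ≤ dist pinf x - t / 4 := by
  have hδ : 0 < t / 40 := by positivity
  obtain ⟨n, ⟨y, hy, hyx, hpy⟩, hn⟩ := ((hf.eventually_exists_near x hδ).and
    (hf.eps_tendsto.eventually_lt_const hδ)).exists
  rw [abs_lt] at hpy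
  -- `3 * t / 8` is midway between the required `t / 4` and `t / 2`; the slack `t / 8` absorbs the
  -- errors, each at most `t / 40`.
  obtain ⟨z, hz, hzy⟩ := (hlength n).exists_dist_eq (p n) y (t := dist (p n) y - 3 * t / 8)
    (by linarith) (by linarith) hδ
  have hzm : z ∈ closedBall (p n) (R n) := by
    rw [mem_closedBall'] at hy ⊢
    linarith
  have h1 := abs_le.1 (hf.approx n z hzm y hy)
  have h2 := abs_le.1 (hf.approx n _ (mem_closedBall_self (hf.rad_pos n).le) z hzm)
  rw [hf.base] at h2
  refine ⟨f n z, ?_, ?_⟩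
  · have := dist_triangle_right x (f n z) (f n y)
    rw [dist_comm x (f n y)] at this
    linarith [h1.2]
  · linarith [h2.2]

theorem pushBall_apply [∀ n, OpensMeasurableSpace (X n)] (hf : IsApproxIsometrySeq m p pinf ε R f)
    (n : ℕ) {A : Set Xinf} (hA : MeasurableSet A) :
    pushBall m p R f n A = m n (f n ⁻¹' A ∩ closedBall (p n) (R n)) := by
  rw [pushBall, Measure.map_apply_of_aemeasurable (hf.aemeasurable n) hA,
    Measure.restrict_apply' measurableSet_closedBall]

variable [∀ n, BorelSpace (X n)] [BorelSpace Xinf] {V : ℕ → ℝ → ℝ} {C : ℝ}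

theorem eventually_le_pushBall (hf : IsApproxIsometrySeq m p pinf ε R f)
    (hvol : ∀ n, HasVolume (m n) C (V n)) (y : Xinf) {r : ℝ} (hr : 0 < r)
    (h : ENNReal.ofReal r < ediam (univ : Set Xinf)) :
    ∀ᶠ n in atTop, ENNReal.ofReal (C⁻¹ * V n r) ≤ pushBall m p R f n (closedBall y (2 * r)) := by
  have hδ : 0 < r / 3 := by positivity
  filter_upwards [hf.eventually_exists_near y hδ, hf.eps_tendsto.eventually_lt_const hδ,
    hf.eventually_ofReal_lt_ediam hr.le h, hf.rad_tendsto.eventually_gt_atTop (dist pinf y + 2 * r)]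
    with n ⟨x, hx, hxy, hpx⟩ hn hdiam hR
  rw [hf.pushBall_apply n measurableSet_closedBall]
  refine (hvol n x r hr hdiam).1.trans (measure_mono fun z hz => ?_)
  rw [mem_ball'] at hz
  rw [abs_lt] at hpx
  have hzm : z ∈ closedBall (p n) (R n) := by
    rw [mem_closedBall']
    linarith [dist_triangle (p n) x z, hpx.2]
  refine ⟨?_, hzm⟩
  have h1 := abs_le.1 (hf.approx n x hx z hzm)
  rw [mem_preimage, mem_closedBall]
  have h2 := dist_triangle_left (f n z) y (f n x)
  linarith [h1.2]

theorem eventually_pushBall_le (hf : IsApproxIsometrySeq m p pinf ε R f)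
    (hvol : ∀ n, HasVolume (m n) C (V n)) (y : Xinf) {r r' : ℝ} (hr : 0 < r) (hr' : r < r')
    (h : ENNReal.ofReal r' < ediam (univ : Set Xinf)) :
    ∀ᶠ n in atTop, pushBall m p R f n (ball y r) ≤ ENNReal.ofReal (C * V n r') := by
  have hδ : 0 < (r' - r) / 3 := by linarith
  filter_upwards [hf.eventually_exists_near y hδ, hf.eps_tendsto.eventually_lt_const hδ,
    hf.eventually_ofReal_lt_ediam (hr.trans hr').le h] with n ⟨x, hx, hxy, _⟩ hn hdiam
  rw [hf.pushBall_apply n measurableSet_ball]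
  refine (measure_mono fun z hz => ?_).trans (hvol n x r' (hr.trans hr') hdiam).2
  have h1 := abs_le.1 (hf.approx n z hz.2 x hx)
  have h2 := mem_ball.1 hz.1
  have h3 := dist_triangle_right (f n z) (f n x) y
  rw [mem_ball]
  linarith [h1.1]

end IsApproxIsometrySeq

/-! ### Existence of limit measures. -/

section LimitMeasure

variable {X : ℕ → Type u} [∀ n, MetricSpace (X n)] [∀ n, MeasurableSpace (X n)]
  [∀ n, BorelSpace (X n)] {m : ∀ n, Measure (X n)} {p : ∀ n, X n} {Xinf : Type v}
  [MetricSpace Xinf] [MeasurableSpace Xinf] [BorelSpace Xinf] {pinf : Xinf} {ε R : ℕ → ℝ}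
  {f : ∀ n, X n → Xinf} {V : ℕ → ℝ → ℝ} {Vinf : ℝ → ℝ} {C α α' : ℝ}

/-- As `ρ` may exceed the diameter, the ball is covered by finitely many small balls where the
volume bound applies. The finitely many remaining `n` are handled by finiteness of each measure. -/
theorem IsApproxIsometrySeq.exists_pushBall_closedBall_le [ProperSpace Xinf] [Nontrivial Xinf]
    [∀ n, IsFiniteMeasure (pushBall m p R f n)]
    (hf : IsApproxIsometrySeq m p pinf ε R f)
    (hvol : ∀ n, HasVolume (m n) C (V n)) (hV : VolumeConverges V Vinf) (y : Xinf) (ρ : ℝ) :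
    ∃ M : ℝ, ∀ n, pushBall m p R f n (closedBall y ρ) ≤ ENNReal.ofReal M := by
  obtain ⟨d, hd0, hd⟩ := exists_pos_ofReal_lt_ediam Xinf
  obtain ⟨T, hT⟩ := (isCompact_closedBall y ρ).elim_finite_subcover (fun z => ball z (d / 2))
    (fun z => isOpen_ball) fun z _ => mem_iUnion.2 ⟨z, mem_ball_self (by positivity)⟩
  have h1 : ∀ᶠ n in atTop, ∀ z ∈ T,
      pushBall m p R f n (ball z (d / 2)) ≤ ENNReal.ofReal (C * V n d) :=
    (Finset.eventually_all T).2 fun z _ =>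
      hf.eventually_pushBall_le hvol z (by positivity) (half_lt_self hd0) hd
  have h2 := ((hV.tendsto hd0).const_mul C).eventually_lt_const (lt_add_one (C * Vinf d))
  have h3 : ∀ᶠ n in atTop, (pushBall m p R f n).real (closedBall y ρ)
      ≤ (∑ _z ∈ T, ENNReal.ofReal (C * Vinf d + 1)).toReal := by
    filter_upwards [h1, h2] with n hn1 hn2
    refine ENNReal.toReal_mono (ENNReal.sum_ne_top.2 fun _ _ => ENNReal.ofReal_ne_top) ?_
    calc pushBall m p R f n (closedBall y ρ) ≤ ∑ z ∈ T, pushBall m p R f n (ball z (d / 2)) :=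
          (measure_mono hT).trans (measure_biUnion_finset_le _ _)
      _ ≤ _ := Finset.sum_le_sum fun z hz =>
          (hn1 z hz).trans (ENNReal.ofReal_le_ofReal hn2.le)
  obtain ⟨M, hM⟩ := (isBoundedUnder_of_eventually_le h3).bddAbove_range
  refine ⟨M, fun n => ?_⟩
  rw [← ofReal_measureReal]
  exact ENNReal.ofReal_le_ofReal (hM (mem_range_self n))

/-- The volume growth passes to vague limits of the push-forward measures. -/
theorem IsApproxIsometrySeq.hasVolume_of_vaguelyTendsto [ProperSpace Xinf]
    [∀ n, IsFiniteMeasure (pushBall m p R f n)]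
    (hf : IsApproxIsometrySeq m p pinf ε R f)
    (hvol : ∀ n, HasVolume (m n) C (V n)) (hC : 1 ≤ C) (hV : VolumeConverges V Vinf)
    (hVinf : IsIncreasingPos Vinf) (hgrowth : HasGrowth C α α' Vinf)
    {s : ℕ → ℕ} (hs : StrictMono s) {ν : Measure Xinf} [IsLocallyFiniteMeasure ν]
    (h : VaguelyTendsto (fun k => pushBall m p R f (s k)) ν) :
    HasVolume ν (C * (C * 4 ^ α')) Vinf := by
  intro y r hr hdiam
  have hC0 : 0 < C := zero_lt_one.trans_le hC
  have hpos := hVinf.1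
  have hball : ν (ball y r) ≠ ∞ :=
    ((measure_mono ball_subset_closedBall).trans_lt (isCompact_closedBall y r).measure_lt_top).ne
  constructor
  -- Radius `r / 4` leaves room for the compact ball of radius `r / 2` inside the open ball; growth
  -- of `Vinf` pays the factor `4 ^ α'`.
  · have h1 : C⁻¹ * Vinf (r / 4) ≤ ν.real (ball y r) := by
      refine h.le_measureReal (isCompact_closedBall y (2 * (r / 4))) isOpen_ball hball
        (closedBall_subset_ball (by linarith))
        (((hV.tendsto (show 0 < r / 4 by positivity)).const_mul C⁻¹).comp hs.tendsto_atTop) ?_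
      have := hf.eventually_le_pushBall hvol y (show 0 < r / 4 by positivity)
        ((ENNReal.ofReal_le_ofReal (by linarith)).trans_lt hdiam)
      filter_upwards [hs.tendsto_atTop.eventually this] with k hk
      rwa [← ofReal_measureReal, ENNReal.ofReal_le_ofReal_iff measureReal_nonneg] at hk
    have h2 := hgrowth.le_mul (c := 4) (r := r / 4) (by norm_num) (by positivity)
      (hpos _ (by positivity))
    rw [show 4 * (r / 4) = r by ring] at h2
    rw [← ofReal_measureReal (μ := ν) (s := ball y r) hball]
    refine ENNReal.ofReal_le_ofReal (le_trans ?_ h1)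
    rw [mul_inv, mul_assoc]
    gcongr
    rwa [inv_mul_le_iff₀ (by positivity)]
  -- The enlarged radius must stay below the diameter, so `2 * r` itself may not be admissible.
  · obtain ⟨r', hr1, hr2, hr3⟩ := exists_lt_ofReal_lt hr.le hdiam (show r < 2 * r by linarith)
    have h1 : ν.real (closedBall y r) ≤ C * Vinf r' := by
      refine h.measureReal_le (isCompact_closedBall y r) (isOpen_ball (x := y) (ε := (r + r') / 2))
        (fun k => measure_ne_top _ _) (closedBall_subset_ball (by linarith))
        (((hV.tendsto (hr.trans hr1)).const_mul C).comp hs.tendsto_atTop) ?_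
      have := hf.eventually_pushBall_le hvol y (r := (r + r') / 2) (by linarith)
        (by linarith) hr3
      filter_upwards [hs.tendsto_atTop.eventually this, (hs.tendsto_atTop.eventually
        ((hV.tendsto (hr.trans hr1)).eventually_const_lt (hpos r' (hr.trans hr1))))] with k hk hk'
      have h0 : 0 ≤ C * V (s k) r' := by positivity
      rwa [← ofReal_measureReal, ENNReal.ofReal_le_ofReal_iff h0] at hk
    refine (measure_mono ball_subset_closedBall).trans ?_
    rw [← ofReal_measureReal (μ := ν) (s := closedBall y r)
      (isCompact_closedBall y r).measure_ne_top]
    refine ENNReal.ofReal_le_ofReal (h1.trans ?_)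
    rw [mul_assoc]
    gcongr
    calc Vinf r' ≤ Vinf (4 * r) := hVinf.2 (hr.trans hr1) (mem_Ioi.2 (by positivity)) (by linarith)
      _ ≤ _ := hgrowth.le_mul (by norm_num) hr (hpos r hr)

theorem IsApproxIsometrySeq.exists_vaguelyTendsto [ProperSpace Xinf] [Nontrivial Xinf]
    [∀ n, IsFiniteMeasure (pushBall m p R f n)]
    (hf : IsApproxIsometrySeq m p pinf ε R f)
    (hvol : ∀ n, HasVolume (m n) C (V n)) (hC : 1 ≤ C) (hV : VolumeConverges V Vinf)
    (hVinf : IsIncreasingPos Vinf) :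
    ∃ (s : ℕ → ℕ) (ν : Measure Xinf), StrictMono s ∧ IsLocallyFiniteMeasure ν ∧
      VaguelyTendsto (fun k => pushBall m p R f (s k)) ν := by
  obtain ⟨d, hd0, hd⟩ := exists_pos_ofReal_lt_ediam Xinf
  have hC0 : 0 < C⁻¹ := inv_pos.2 (zero_lt_one.trans_le hC)
  choose M hM using fun j : ℕ => hf.exists_pushBall_closedBall_le hvol hV pinf (j + 1)
  have hVd := hVinf.1 d hd0
  -- The lower mass bound holds only from `N` on, so the sequence is shifted.
  obtain ⟨N, hN⟩ := eventually_atTop.1 ((hf.eventually_le_pushBall hvol pinf hd0 hd).and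
    ((hV.tendsto hd0).eventually_const_lt (half_lt_self hVd)))
  obtain ⟨k₀, hk₀⟩ := exists_nat_ge (2 * d)
  obtain ⟨s, ν, hs, hν, hlim⟩ := exists_subseq_tendsto_integral_of_hasCompactSupport pinf
    (fun n => pushBall m p R f (n + N)) M (fun n j => hM j (n + N))
    (c := C⁻¹ * (Vinf d / 2)) (by positivity) (k₀ := k₀) fun n => by
      obtain ⟨h1, h2⟩ := hN (n + N) (Nat.le_add_left N n)
      refine le_trans (ENNReal.ofReal_le_ofReal ?_)
        (h1.trans (measure_mono (closedBall_subset_closedBall hk₀)))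
      gcongr
  exact ⟨fun k => s k + N, ν, hs.add_const N, hν, hlim⟩

theorem IsApproxIsometrySeq.exists_isLimitMeasure [CompleteSpace Xinf] [Nontrivial Xinf]
    [∀ n, ProperSpace (X n)] [∀ n, IsFiniteMeasureOnCompacts (m n)]
    (hf : IsApproxIsometrySeq m p pinf ε R f) (hlength : ∀ n, IsLengthSpace (X n))
    (hvol : ∀ n, HasVolume (m n) C (V n)) (hC : 1 ≤ C) (hV : VolumeConverges V Vinf)
    (hVinf : IsIncreasingPos Vinf) (hgrowth : HasGrowth C α α' Vinf) (hα' : 0 < α') :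
    ∃ (s : ℕ → ℕ) (minf : Measure Xinf), IsLimitMeasure m p pinf Vinf R f s minf := by
  have := hf.properSpace
  have := isFiniteMeasure_pushBall m p R f
  obtain ⟨s, ν, hs, hν, hlim⟩ := hf.exists_vaguelyTendsto hvol hC hV hVinf
  have hC0 := zero_lt_one.trans_le hC
  have hvolν := hf.hasVolume_of_vaguelyTendsto hvol hC hV hVinf hgrowth hs hlim
  have hdbl := hvolν.isUnifLocDoublingMeasure (by positivity) hgrowth hC0 hVinf.1
  have h4 : (1 : ℝ) ≤ 4 ^ α' := Real.one_le_rpow (by norm_num) hα'.le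
  refine ⟨s, ν, hs, inferInstance, ⟨_, one_le_mul_of_one_le_of_one_le hC
    (one_le_mul_of_one_le_of_one_le hC h4), hvolν⟩, fun r hr φ hφ hbdd => ?_⟩
  obtain ⟨M, hM⟩ := hbdd
  have hr0 : 0 < r := by
    rcases hr with ⟨q, hq, rfl⟩ | ⟨n, rfl⟩
    · exact_mod_cast hq
    · exact hf.rad_pos n
  refine hlim.tendsto_setIntegral_ball pinf r ?_ hφ.continuousOn hM
  refine measure_sphere_eq_zero_of_porous ν pinf hr0 fun x hx t ht htr => ?_
  have hx' : dist pinf x = r := mem_sphere'.1 hx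
  rw [← hx'] at htr ⊢
  exact hf.exists_dist_le hlength x ht htr

end LimitMeasure

/-! ### The dense subspace and the operators between the `L²` spaces. -/

section HilbertSpaces

theorem dense_ccL2 {Y : Type v} [MetricSpace Y] [ProperSpace Y] [MeasurableSpace Y] [BorelSpace Y]
    (μ : Measure Y) [μ.Regular] : Dense (ccL2 μ : Set (Lp ℝ 2 μ)) := by
  intro g
  rw [EMetric.mem_closure_iff]
  intro δ hδ
  obtain ⟨δ', hδ'0, hδ'⟩ := exists_between hδ
  obtain ⟨w, hwc, hw, hcont, hmem⟩ := (Lp.memLp g).exists_hasCompactSupport_eLpNorm_sub_le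
    ENNReal.ofNat_ne_top hδ'0.ne'
  refine ⟨hmem.toLp w, ⟨w, hcont, hwc, hmem.coeFn_toLp⟩, lt_of_le_of_lt ?_ hδ'⟩
  rw [Lp.edist_def]
  refine le_trans (le_of_eq (eLpNorm_congr_ae ?_)) hw
  exact (EventuallyEq.refl _ _).sub hmem.coeFn_toLp

/-- This is what makes continuous representatives of `L²` classes unique. -/
theorem HasVolume.isOpenPosMeasure {Y : Type v} [MetricSpace Y] [Nontrivial Y] [MeasurableSpace Y]
    {μ : Measure Y} {C : ℝ} {V : ℝ → ℝ} (h : HasVolume μ C V) (hC : 0 < C)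
    (hV : ∀ r, 0 < r → 0 < V r) : μ.IsOpenPosMeasure := by
  refine ⟨fun U hU hne h0 => ?_⟩
  obtain ⟨y, hy⟩ := hne
  obtain ⟨r, hr, hrU⟩ := Metric.isOpen_iff.1 hU y hy
  obtain ⟨d, hd0, hd⟩ := exists_pos_ofReal_lt_ediam Y
  have h1 := (h y (min r d) (lt_min hr hd0)
    ((ENNReal.ofReal_le_ofReal (min_le_right _ _)).trans_lt hd)).1
  have h2 : μ (ball y (min r d)) = 0 :=
    measure_mono_null ((ball_subset_ball (min_le_left _ _)).trans hrU) h0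
  rw [h2, nonpos_iff_eq_zero, ENNReal.ofReal_eq_zero] at h1
  have := hV _ (lt_min hr hd0)
  exact absurd h1 (not_le.2 (by positivity))

variable {X : Type u} [MetricSpace X] [ProperSpace X] [MeasurableSpace X] [BorelSpace X]
  {μ : Measure X} [IsFiniteMeasureOnCompacts μ] {Y : Type v} [MetricSpace Y] [ProperSpace Y]
  [MeasurableSpace Y] [BorelSpace Y] {p : X} {r : ℝ} {f : X → Y}

omit [ProperSpace Y] in
theorem memLp_indicator_comp (hf : AEMeasurable f (μ.restrict (closedBall p r)))
    {w : Y → ℝ} (hw : Continuous w) (hwc : HasCompactSupport w) :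
    MemLp ((closedBall p r).indicator (w ∘ f)) 2 μ := by
  rw [memLp_indicator_iff_restrict measurableSet_closedBall]
  have : IsFiniteMeasure (μ.restrict (closedBall p r)) :=
    ⟨by
      rw [Measure.restrict_apply_univ]
      exact (isCompact_closedBall _ _).measure_lt_top⟩
  obtain ⟨M, hM⟩ := hwc.exists_bound_of_continuous hw
  exact MemLp.of_bound (hw.measurable.comp_aemeasurable hf).aestronglyMeasurable M
    (Eventually.of_forall fun x => hM (f x))

omit [ProperSpace Y] in
/-- The operator `u ↦ (u ∘ f) · 1_{closed ball}` from classes of continuous compactly supported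
functions to `L²`. -/
theorem exists_linearMap_indicator_comp (hf : AEMeasurable f (μ.restrict (closedBall p r)))
    (ν : Measure Y) [ν.IsOpenPosMeasure] :
    ∃ Φ : ccL2 ν →ₗ[ℝ] Lp ℝ 2 μ, ∀ (w : ccL2 ν) (w₀ : Y → ℝ), Continuous w₀ →
      HasCompactSupport w₀ → (w : Lp ℝ 2 ν) =ᵐ[ν] w₀ →
      Φ w =ᵐ[μ] (closedBall p r).indicator (w₀ ∘ f) := by
  choose rep hc hcs hrep using fun w : ccL2 ν => w.2
  -- Uniqueness makes the chosen representatives additive and homogeneous, hence the map linear.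
  have huniq : ∀ (w : ccL2 ν) (w₀ : Y → ℝ), Continuous w₀ → (w : Lp ℝ 2 ν) =ᵐ[ν] w₀ →
      rep w = w₀ := fun w w₀ h0 h => Continuous.ae_eq_iff_eq ν (hc w) h0 |>.1 ((hrep w).symm.trans h)
  refine ⟨{ toFun := fun w => (memLp_indicator_comp hf (hc w) (hcs w)).toLp _
            map_add' := fun a b => ?_
            map_smul' := fun c a => ?_ }, fun w w₀ h0 _ h => ?_⟩
  · have h1 : rep (a + b) = rep a + rep b := huniq _ _ ((hc a).add (hc b))
      ((Lp.coeFn_add _ _).trans ((hrep a).add (hrep b)))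
    rw [← MemLp.toLp_add]
    refine MemLp.toLp_congr _ _ (Eventually.of_forall fun x => ?_)
    rw [h1, ← indicator_add']
    rfl
  · have h1 : rep (c • a) = c • rep a := huniq _ _ ((hc a).const_smul c)
      ((Lp.coeFn_smul _ _).trans ((hrep a).const_smul c))
    rw [RingHom.id_apply, ← MemLp.toLp_const_smul]
    refine MemLp.toLp_congr _ _ (Eventually.of_forall fun x => ?_)
    rw [h1]
    exact indicator_const_smul_apply (closedBall p r) c (rep a ∘ f) x
  · rw [← huniq w w₀ h0 h]
    exact (memLp_indicator_comp hf (hc w) (hcs w)).coeFn_toLp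

theorem norm_sq_eq_integral {Z : Type*} [MeasurableSpace Z] {μ : Measure Z} (g : Lp ℝ 2 μ)
    {w : Z → ℝ} (h : g =ᵐ[μ] w) : ‖g‖ ^ 2 = ∫ z, w z ^ 2 ∂μ := by
  rw [← real_inner_self_eq_norm_sq, L2.inner_def]
  refine integral_congr_ae ?_
  filter_upwards [h] with z hz
  rw [real_inner_self_eq_norm_sq, Real.norm_eq_abs, sq_abs, hz]

end HilbertSpaces

/-! ### Convergence of norms and the main theorem. -/

/-- Convergence of the norms of `(w ∘ f) · 1_{closed ball}`. -/
theorem IsLimitMeasure.tendsto_norm {X : ℕ → Type u} [∀ n, MetricSpace (X n)]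
    [∀ n, MeasurableSpace (X n)] [∀ n, BorelSpace (X n)] {m : ∀ n, Measure (X n)} {p : ∀ n, X n}
    {Xinf : Type v} [MetricSpace Xinf] [ProperSpace Xinf] [MeasurableSpace Xinf]
    [BorelSpace Xinf] {pinf : Xinf} {Vinf : ℝ → ℝ} {ε R : ℕ → ℝ} {f : ∀ n, X n → Xinf}
    {s : ℕ → ℕ} {minf : Measure Xinf} (h : IsLimitMeasure m p pinf Vinf R f s minf)
    (hf : IsApproxIsometrySeq m p pinf ε R f) {w : Xinf → ℝ} (hw : Continuous w)
    (hwc : HasCompactSupport w) (g : Lp ℝ 2 minf) (hg : g =ᵐ[minf] w)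
    (G : ∀ k, Lp ℝ 2 (m (s k)))
    (hG : ∀ k, G k =ᵐ[m (s k)] (closedBall (p (s k)) (R (s k))).indicator (w ∘ f (s k))) :
    Tendsto (fun k => ‖G k‖) atTop (𝓝 ‖g‖) := by
  -- An integer radius is rational, so weak convergence is available on this ball.
  obtain ⟨q, hq⟩ : ∃ q : ℕ, tsupport w ⊆ ball pinf ((q : ℝ) + 1) := by
    obtain ⟨ρ, hρ⟩ := hwc.isBounded.subset_closedBall pinf
    obtain ⟨q, hq⟩ := exists_nat_ge ρ
    exact ⟨q, hρ.trans (closedBall_subset_ball (by linarith))⟩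
  have hzero : ∀ y, y ∉ ball pinf ((q : ℝ) + 1) → w y ^ 2 = 0 := fun y hy => by
    rw [image_eq_zero_of_notMem_tsupport fun h' => hy (hq h'), zero_pow two_ne_zero]
  have hcs : HasCompactSupport fun y => w y ^ 2 :=
    hwc.comp_left (g := fun x : ℝ => x ^ 2) (zero_pow two_ne_zero)
  have hcont : Continuous fun y => w y ^ 2 := hw.pow 2
  obtain ⟨M, hM⟩ := hcs.exists_bound_of_continuous hcont
  have hlim := h.weak ((q : ℝ) + 1) (Or.inl ⟨q + 1, by positivity, by push_cast; rfl⟩)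
    (fun y => w y ^ 2)
    (hcs.uniformContinuous_of_continuous hcont).uniformContinuousOn ⟨M, fun y _ => hM y⟩
  simp only [setIntegral_eq_integral_of_forall_compl_eq_zero hzero] at hlim
  rw [← norm_sq_eq_integral g hg] at hlim
  have hnorm : ∀ k, ∫ y, w y ^ 2 ∂(pushBall m p R f (s k)) = ‖G k‖ ^ 2 := fun k => by
    rw [norm_sq_eq_integral _ (hG k), pushBall,
      integral_map (hf.aemeasurable _) hcont.aestronglyMeasurable,
      ← integral_indicator measurableSet_closedBall]
    refine integral_congr_ae (Eventually.of_forall fun x => ?_)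
    by_cases hx : x ∈ closedBall (p (s k)) (R (s k))
    · simp only [indicator_of_mem hx, Function.comp]
    · simp only [indicator_of_notMem hx]
      norm_num
  simp only [hnorm] at hlim
  simpa [Real.sqrt_sq] using hlim.sqrt

/-- Convergence of the `L²`-spaces along a pointed Gromov-Hausdorff convergent sequence. -/
theorem theorem3p4
    {X : ℕ → Type u} [∀ n, MetricSpace (X n)] [∀ n, ProperSpace (X n)]
    [∀ n, MeasurableSpace (X n)] [∀ n, BorelSpace (X n)]
    (m : ∀ n, Measure (X n)) [∀ n, (m n).Regular] (p : ∀ n, X n)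
    {Xinf : Type v} [MetricSpace Xinf] [CompleteSpace Xinf] [Nontrivial Xinf]
    [MeasurableSpace Xinf] [BorelSpace Xinf] (pinf : Xinf)
    (V : ℕ → ℝ → ℝ) (Vinf : ℝ → ℝ)
    (hA4 : UniformVolumeGrowth X m V Vinf)
    (hA5 : VolumeConverges V Vinf)
    (hlength : ∀ n, IsLengthSpace (X n))
    (hGH : PointedGHConverges X p Xinf pinf) :
    -- approximate isometries exist
    (∃ (ε R : ℕ → ℝ) (f : ∀ n, X n → Xinf), IsApproxIsometrySeq m p pinf ε R f) ∧
    ∀ (ε R : ℕ → ℝ) (f : ∀ n, X n → Xinf), IsApproxIsometrySeq m p pinf ε R f →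
      -- a limit measure exists
      (∃ (s : ℕ → ℕ) (minf : Measure Xinf), IsLimitMeasure m p pinf Vinf R f s minf) ∧
      -- every limit measure gives convergence of the `L²`-spaces
      ∀ (s : ℕ → ℕ) (minf : Measure Xinf), IsLimitMeasure m p pinf Vinf R f s minf →
        (∃ Φ : ∀ k, ccL2 minf →ₗ[ℝ] Lp ℝ 2 (m (s k)),
          (∀ (k : ℕ) (w : ccL2 minf) (w₀ : Xinf → ℝ), Continuous w₀ → HasCompactSupport w₀ →
            (w : Lp ℝ 2 minf) =ᵐ[minf] w₀ →
            Φ k w =ᵐ[m (s k)]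
              (closedBall (p (s k)) (R (s k))).indicator (w₀ ∘ f (s k))) ∧
          L2ConvergesVia (fun k => m (s k)) minf (ccL2 minf) Φ) ∧
        L2Converges (fun k => m (s k)) minf := by
  obtain ⟨Vl, Vu, α, α', C, -, hα', hC, hVpos, hVinf, -, -, hgrowth, -, -, hvol, -, -⟩ := hA4
  have hgrowthInf : HasGrowth C α α' Vinf :=
    HasGrowth.of_tendsto hgrowth hVinf.1 fun r hr => hA5.tendsto hr
  refine ⟨exists_isApproxIsometrySeq m p pinf hlength hGH, fun ε R f hf =>
    ⟨hf.exists_isLimitMeasure hlength hvol hC hA5 hVinf hgrowthInf hα', fun s minf hlim => ?_⟩⟩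
  have := hf.properSpace
  have := hlim.radon
  obtain ⟨C', hC', hvol'⟩ := hlim.volume
  have := hvol'.isOpenPosMeasure (zero_lt_one.trans_le hC') hVinf.1
  choose Φ hΦ using fun k => exists_linearMap_indicator_comp (hf.aemeasurable (s k)) minf
  have hconv : L2ConvergesVia (fun k => m (s k)) minf (ccL2 minf) Φ := by
    refine ⟨dense_ccL2 minf, fun w => ?_⟩
    obtain ⟨w₀, hw₀, hw₀c, hw⟩ := w.2
    exact hlim.tendsto_norm hf hw₀ hw₀c w hw _ fun k => hΦ k w w₀ hw₀ hw₀c hw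
  exact ⟨⟨Φ, hΦ, hconv⟩, ccL2 minf, Φ, hconv⟩
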